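/- A \emph{pivotal participation game} $(\vec e,\vec m,\tau)$ has $n\ge 0$ agents with endowments $e_i\ge 0$ and reward levels $0<m_i<1$, and a threshold $\tau\ge 0$. For a set $S\subseteq[n]$ of participating agents let $e(S)=\sum_{j\in S}e_j$; the project succeeds if $e(S)\ge\tau$, and the utility of agent $i$ is $$U_i(S)=e_i\,\mathbf 1[i\notin S]+m_i\,e(S)\,\mathbf 1[e(S)\ge\tau].$$ The set $S$ is a \emph{cooperative Nash equilibrium} if $e(S)\ge\tau$, $U_i(S)\ge U_i(S\setminus\{i\})$ for all $i\in S$, and $U_i(S)\ge U_i(S\cup\{i\})$ for all $i\notin S$. The set $S$ is \emph{minimal} if $e(S)\ge\tau$ and $e(S\setminus\{j\})<\tau$ for every $j\in S$. The game is \emph{balanced} if all its minimal sets have the same cardinality. \textbf{Theorem.} Deciding the existence of a cooperative Nash equilibrium is in P for balanced pivotal participation games: with instances $(\vec e,\vec m,\tau)$ whose entries are rational numbers, written as numerators and denominators in binary, there is a language $L$ in P (decided by a deterministic Turing machine in time polynomial in the length of the input, on every input string) such that for every balanced instance, its encoding belongs to $L$ if and only if the instance has a cooperative Nash equilibrium.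 -/

import Mathlib

/-- A pivotal participation game with `n` agents: endowments `e i ≥ 0`, reward levels
`0 < m i < 1` and a threshold `τ ≥ 0`. -/
structure PivotalGame (n : ℕ) where
  e : Fin n → ℝ
  m : Fin n → ℝ
  τ : ℝ
  e_nonneg : ∀ i, 0 ≤ e i
  m_pos : ∀ i, 0 < m i
  m_lt_one : ∀ i, m i < 1
  τ_nonneg : 0 ≤ τ

namespace PivotalGame

variable {n : ℕ} (G : PivotalGame n)

/-- `e(S)`: the total contribution when exactly the agents in `S` participate. -/
def contribution (S : Finset (Fin n)) : ℝ := ∑ j ∈ S, G.e j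

/-- The project succeeds when the agents in `S` participate. -/
def Succeeds (S : Finset (Fin n)) : Prop := G.τ ≤ G.contribution S

open Classical in
/-- `U_i(S) = e_i 1[i ∉ S] + m_i e(S) 1[e(S) ≥ τ]`. -/
noncomputable def utility (i : Fin n) (S : Finset (Fin n)) : ℝ :=
  (if i ∉ S then G.e i else 0) + (if G.Succeeds S then G.m i * G.contribution S else 0)

/-- No agent gains by a unilateral deviation. -/
def IsNash (S : Finset (Fin n)) : Prop :=
  (∀ i ∈ S, G.utility i (S.erase i) ≤ G.utility i S) ∧
    (∀ i ∉ S, G.utility i (insert i S) ≤ G.utility i S)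

/-- A Nash equilibrium at which the project succeeds. -/
def IsCooperativeNash (S : Finset (Fin n)) : Prop := G.IsNash S ∧ G.Succeeds S

/-- `S` succeeds, and removing any single member makes the project fail. -/
def IsMinimal (S : Finset (Fin n)) : Prop :=
  G.Succeeds S ∧ ∀ j ∈ S, G.contribution (S.erase j) < G.τ

/-- All minimal subsets of agents have the same cardinality. -/
def IsBalanced : Prop :=
  ∀ S T : Finset (Fin n), G.IsMinimal S → G.IsMinimal T → S.card = T.card

end PivotalGame

/-- A pivotal participation game whose parameters are rational numbers, so that it can be written
down as a finite string. -/
structure RationalInstance where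
  n : ℕ
  e : Fin n → ℚ
  m : Fin n → ℚ
  τ : ℚ
  e_nonneg : ∀ i, 0 ≤ e i
  m_pos : ∀ i, 0 < m i
  m_lt_one : ∀ i, m i < 1
  τ_nonneg : 0 ≤ τ

namespace RationalInstance

/-- The pivotal participation game described by a rational instance. -/
noncomputable def toGame (I : RationalInstance) : PivotalGame I.n where
  e i := (I.e i : ℝ)
  m i := (I.m i : ℝ)
  τ := (I.τ : ℝ)
  e_nonneg i := by exact_mod_cast I.e_nonneg i
  m_pos i := by exact_mod_cast I.m_pos i
  m_lt_one i := by exact_mod_cast I.m_lt_one i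
  τ_nonneg := by exact_mod_cast I.τ_nonneg

/-- A nonnegative rational as its numerator and denominator in lowest terms. -/
def ratData (q : ℚ) : List ℕ := [q.num.toNat, q.den]

/-- The sequence `τ, e_1, m_1, …, e_n, m_n`, each entry as numerator and denominator. -/
def data (I : RationalInstance) : List ℕ :=
  ratData I.τ ++ (List.finRange I.n).flatMap fun i => ratData (I.e i) ++ ratData (I.m i)

/-- A natural number in binary, terminated by a comma. -/
def encodeNatField (k : ℕ) : List Computability.Γ' :=
  (Computability.encodeNat k).map Computability.Γ'.bit ++ [Computability.Γ'.comma]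

/-- The input string: the entries of `data` in binary, each terminated by a comma. -/
def encode (I : RationalInstance) : List Computability.Γ' := I.data.flatMap encodeNatField

theorem encodeNatField_append_inj {a b : ℕ} {u v : List Computability.Γ'}
    (h : encodeNatField a ++ u = encodeNatField b ++ v) : a = b ∧ u = v := by
  have key : ∀ (x y : List Bool),
      x.map Computability.Γ'.bit ++ Computability.Γ'.comma :: u =
        y.map Computability.Γ'.bit ++ Computability.Γ'.comma :: v → x = y ∧ u = v := by
    intro x
    induction x with
    | nil => intro y hy; cases y <;> simp_all
    | cons c x ih =>
      intro y hy
      cases y with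
      | nil => simp at hy
      | cons d y =>
        simp only [List.map_cons, List.cons_append, List.cons.injEq,
          Computability.Γ'.bit.injEq] at hy
        obtain ⟨h1, h2⟩ := ih y hy.2
        exact ⟨by rw [hy.1, h1], h2⟩
  simp only [encodeNatField, List.append_assoc, List.singleton_append] at h
  obtain ⟨h1, h2⟩ := key _ _ h
  refine ⟨?_, h2⟩
  have := congrArg Computability.decodeNat h1
  simpa using this

theorem flatMap_encodeNatField_injective :
    Function.Injective fun l : List ℕ => l.flatMap encodeNatField := by
  intro l
  induction l with
  | nil => intro l' h; cases l' <;> simp_all [encodeNatField]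
  | cons a l ih =>
    intro l' h
    cases l' with
    | nil => simp [encodeNatField] at h
    | cons b l' =>
      simp only [List.flatMap_cons] at h
      obtain ⟨h1, h2⟩ := encodeNatField_append_inj h
      rw [h1, ih h2]

theorem ratData_inj {p q : ℚ} (hp : 0 ≤ p) (hq : 0 ≤ q) (h : ratData p = ratData q) : p = q := by
  simp only [ratData, List.cons.injEq, and_true] at h
  have h1 := Rat.num_nonneg.2 hp
  have h2 := Rat.num_nonneg.2 hq
  exact Rat.ext (by omega) h.2

/-- Different instances have different input strings. -/
theorem encode_injective : Function.Injective encode := by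
  have split : ∀ {p q : ℚ} {u v : List ℕ}, 0 ≤ p → 0 ≤ q →
      ratData p ++ u = ratData q ++ v → p = q ∧ u = v := by
    intro p q u v hp hq h
    obtain ⟨h1, h2⟩ := List.append_inj h rfl
    exact ⟨ratData_inj hp hq h1, h2⟩
  rintro ⟨n, e, m, τ, he, hm, hm1, hτ⟩ ⟨n', e', m', τ', he', hm', hm1', hτ'⟩ h
  have h := flatMap_encodeNatField_injective h
  obtain ⟨rfl, h⟩ := split hτ hτ' h
  have hn : n = n' := by
    have := congrArg List.length h
    simp [ratData, List.length_flatMap] at this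
    omega
  subst hn
  have key : ∀ l : List (Fin n),
      (l.flatMap fun i => ratData (e i) ++ ratData (m i)) =
        (l.flatMap fun i => ratData (e' i) ++ ratData (m' i)) →
      ∀ i ∈ l, e i = e' i ∧ m i = m' i := by
    intro l
    induction l with
    | nil => simp
    | cons a l ih =>
      intro h
      simp only [List.flatMap_cons, List.append_assoc] at h
      obtain ⟨h1, h⟩ := split (he a) (he' a) h
      obtain ⟨h2, h⟩ := split (hm a).le (hm' a).le h
      intro i hi
      rcases List.mem_cons.1 hi with rfl | hi
      · exact ⟨h1, h2⟩
      · exact ih h i hi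
  have key := fun i => key _ h i (List.mem_finRange i)
  obtain rfl : e = e' := funext fun i => (key i).1
  obtain rfl : m = m' := funext fun i => (key i).2
  rfl

end RationalInstance

open Classical in
/-- The complexity class P: a deterministic multi-stack Turing machine decides membership in `L`
(output `true` or `false`) on every input string, in a number of steps that is bounded by a
polynomial in the length of the string. -/
def InP {Γ : Type} (L : Language Γ) : Prop :=
  Nonempty (Turing.TM2ComputableInPolyTime (id : List Γ → List Γ) Computability.encodeBool
    fun w => decide (w ∈ L))

/-! The mathematical core is a reduction to polynomially many candidate sets. Since `m i < 1`, a
member with positive endowment of a cooperative equilibrium `S` must be pivotal, for otherwise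
leaving would pay; being pivotal, it stays exactly when its demand `e i / m i` is at most `e(S)`.
Outsiders never want to join. Conversely, a successful set all of whose members are pivotal and have
demand at most its contribution is a cooperative equilibrium (`isCooperativeNash_of_pivotal`,
`IsCooperativeNash.pivotal`).

If `τ = 0`, the empty set works. If `τ > 0`, let `S'` be the positive part of `S`, a minimal set
with the same contribution, let `t` be the largest demand in `S'`, and let `A` be the set of all
agents with demand at most `t`. Taking agents of `A` by decreasing endowment until `τ` is reached
yields a minimal set `P`. Balancedness gives `S'` and `P` the same cardinality, and `P` consists of
heaviest agents of `A`, so `e(P) ≥ e(S') ≥ t` (`IsBalanced.contribution_le`). Hence `P` is an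
equilibrium too. The set `P` is determined, up to agents of equal endowment, by the agent `i`
attaining `t` and the weight of the last agent `j` taken, so trying all pairs `(i, j)` suffices.
Acceptance is sound without balancedness; only completeness uses it.

Membership in P is proved on an actual machine. Structured stack programs with a step count are
compiled to multi-stack Turing machines (`Run.iterate_step`). Data are binary trees in prefix
notation, and a program computing a function acts on the top tree of one stack, leaving everything
below untouched. The resulting class `PolyTime` is closed under composition, pairing, case
distinction and folds with polynomially bounded intermediate sizes; binary arithmetic and the search
are written as such folds. -/

open Computability Turing

/-! ### Stack programs with step-counted semantics -/

/-- The work stacks of a stack program. -/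
inductive Reg
  | inp | a | b | c | n
  deriving DecidableEq

instance : Fintype Reg := ⟨{.inp, .a, .b, .c, .n}, fun r => by cases r <;> decide⟩

/-- The register `cur` holding the last popped symbol, and the contents of the work stacks. -/
@[ext] structure Store where
  cur : Option Γ'
  inp : List Γ'
  a : List Γ'
  b : List Γ'
  c : List Γ'
  n : List Γ'

namespace Store

def get (s : Store) : Reg → List Γ'
  | .inp => s.inp
  | .a => s.a
  | .b => s.b
  | .c => s.c
  | .n => s.n

def set (s : Store) (l : List Γ') : Reg → Store
  | .inp => { s with inp := l }
  | .a => { s with a := l }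
  | .b => { s with b := l }
  | .c => { s with c := l }
  | .n => { s with n := l }

end Store

/-- Structured programs on stacks. -/
inductive Prog
  | skip
  | push (r : Reg) (f : Option Γ' → Γ')
  | pop (r : Reg)
  | seq (p q : Prog)
  | cond (t : Option Γ' → Bool) (p q : Prog)
  | loop (t : Option Γ' → Bool) (p : Prog)

/-- `Run p s u k`: started in `s`, the program `p` terminates in `u` after at most `k` steps. -/
inductive Run : Prog → Store → Store → ℕ → Prop
  | skip (s) : Run .skip s s 1
  | push (r f s) : Run (.push r f) s (s.set (f s.cur :: s.get r) r) 1
  | pop (r s) : Run (.pop r) s { s.set (s.get r).tail r with cur := (s.get r).head? } 1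
  | seq {p q s u w j k} : Run p s u j → Run q u w k → Run (.seq p q) s w (j + k)
  | cond_true {t p q s u k} : t s.cur = true → Run p s u k → Run (.cond t p q) s u (k + 1)
  | cond_false {t p q s u k} : t s.cur = false → Run q s u k → Run (.cond t p q) s u (k + 1)
  | loop_done {t p s} : t s.cur = false → Run (.loop t p) s s 1
  | loop_step {t p s u w j k} : t s.cur = true → Run p s u j → Run (.loop t p) u w k →
      Run (.loop t p) s w (j + k + 1)
  | weaken {p s u j k} : Run p s u j → j ≤ k → Run p s u k

/-! ### Compilation of stack programs to Turing machines -/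

namespace Prog

/-- The labels of the machine code of a program. -/
def Lab : Prog → Type
  | skip => Unit
  | push _ _ => Unit
  | pop _ => Unit
  | seq p q => p.Lab ⊕ q.Lab
  | cond _ p q => Option (p.Lab ⊕ q.Lab)
  | loop _ p => Option p.Lab

noncomputable instance labFintype : (p : Prog) → Fintype p.Lab
  | skip => inferInstanceAs (Fintype Unit)
  | push _ _ => inferInstanceAs (Fintype Unit)
  | pop _ => inferInstanceAs (Fintype Unit)
  | seq p q =>
    haveI := labFintype p
    haveI := labFintype q
    inferInstanceAs (Fintype (p.Lab ⊕ q.Lab))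
  | cond _ p q =>
    haveI := labFintype p
    haveI := labFintype q
    inferInstanceAs (Fintype (Option (p.Lab ⊕ q.Lab)))
  | loop _ p =>
    haveI := labFintype p
    inferInstanceAs (Fintype (Option p.Lab))

/-- For `cond` and `loop` the additional label `none` carries the test. -/
def entry : (p : Prog) → p.Lab
  | skip => ()
  | push _ _ => ()
  | pop _ => ()
  | seq p _ => Sum.inl p.entry
  | cond _ _ _ => (none : Option _)
  | loop _ _ => (none : Option _)

/-- The alphabets of the machine: the output stack `none` holds Booleans. -/
abbrev Alphabet : Option Reg → Type
  | none => Bool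
  | some _ => Γ'

abbrev Code (Λ : Type) := TM2.Stmt Alphabet Λ (Option Γ')

/-- Machine code of a program; `emb` places its labels in those of the whole machine and `exit` is
the label at which the machine continues afterwards. -/
def code {Λ : Type} : (p : Prog) → (emb : p.Lab → Λ) → (exit : Λ) → p.Lab → Code Λ
  | skip, _, exit, _ => .goto fun _ => exit
  | push r f, _, exit, _ => .push (some r) f (.goto fun _ => exit)
  | pop r, _, exit, _ => .pop (some r) (fun _ x => x) (.goto fun _ => exit)
  | seq p q, emb, exit, l =>
    Sum.casesOn (motive := fun _ => Code Λ) l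
      (p.code (fun x => emb (Sum.inl x)) (emb (Sum.inr q.entry)))
      (q.code (fun x => emb (Sum.inr x)) exit)
  | cond t p q, emb, exit, l =>
    Option.casesOn (motive := fun _ => Code Λ) l
      (.branch t (.goto fun _ => emb (some (Sum.inl p.entry)))
        (.goto fun _ => emb (some (Sum.inr q.entry))))
      fun l => Sum.casesOn (motive := fun _ => Code Λ) l
        (p.code (fun x => emb (some (Sum.inl x))) exit)
        (q.code (fun x => emb (some (Sum.inr x))) exit)
  | loop t p, emb, exit, l =>
    Option.casesOn (motive := fun _ => Code Λ) l
      (.branch t (.goto fun _ => emb (some p.entry)) (.goto fun _ => exit))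
      (p.code (fun x => emb (some x)) (emb none))

end Prog

namespace Store

/-- The stacks of the machine, with empty output stack. -/
def stk (s : Store) : (k : Option Reg) → List (Prog.Alphabet k)
  | none => ([] : List Bool)
  | some r => s.get r

def cfg {Λ : Type} (s : Store) (l : Λ) : TM2.Cfg Prog.Alphabet Λ (Option Γ') := ⟨some l, s.cur, s.stk⟩

theorem update_stk (s : Store) (r : Reg) (l : List Γ') :
    Function.update s.stk (some r) l = (s.set l r).stk := by
  funext k
  rcases k with _ | k
  · rfl
  · cases r <;> cases k <;> simp [stk, set, get, Function.update]

end Store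

open Function in
/-- The machine code of a program performs the runs of the program. -/
theorem Run.iterate_step {Λ : Type} {M : Λ → Prog.Code Λ} {p : Prog} {s u : Store} {k : ℕ}
    (h : Run p s u k) : ∀ (emb : p.Lab → Λ) (exit : Λ), (∀ l, M (emb l) = p.code emb exit l) →
      ∃ j ≤ k, (flip bind (TM2.step M))^[j] (some (s.cfg (emb p.entry))) = some (u.cfg exit) := by
  induction h with
  | skip s =>
    intro emb exit hM
    refine ⟨1, le_rfl, ?_⟩
    simp [flip, Store.cfg, hM, Prog.code]
  | push r f s =>
    intro emb exit hM
    refine ⟨1, le_rfl, ?_⟩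
    have := s.update_stk r (f s.cur :: s.get r)
    simp only [flip, Store.cfg, hM, Prog.code, iterate_one, Option.bind_eq_bind, Option.bind_some,
      TM2.step, TM2.stepAux]
    refine congrArg some ?_
    refine (congrArg (TM2.Cfg.mk (some exit) s.cur) this).trans ?_
    cases r <;> rfl
  | pop r s =>
    intro emb exit hM
    refine ⟨1, le_rfl, ?_⟩
    have := s.update_stk r (s.get r).tail
    simp only [flip, Store.cfg, hM, Prog.code, iterate_one, Option.bind_eq_bind, Option.bind_some,
      TM2.step, TM2.stepAux]
    refine congrArg some ?_
    refine (congrArg (TM2.Cfg.mk (some exit) (s.get r).head?) this).trans ?_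
    cases r <;> congr 1
  | @seq p q s u w j k _ _ ih₁ ih₂ =>
    intro emb exit hM
    obtain ⟨i₁, h₁, e₁⟩ := ih₁ (fun x => emb (Sum.inl x)) (emb (Sum.inr q.entry))
      fun l => hM (Sum.inl l)
    obtain ⟨i₂, h₂, e₂⟩ := ih₂ (fun x => emb (Sum.inr x)) exit fun l => hM (Sum.inr l)
    refine ⟨i₂ + i₁, by omega, ?_⟩
    rw [iterate_add_apply]
    exact (congrArg _ e₁).trans e₂
  | @cond_true t p q s u k ht _ ih =>
    intro emb exit hM
    obtain ⟨i, h, e⟩ := ih (fun x => emb (some (Sum.inl x))) exit fun l => hM (some (Sum.inl l))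
    refine ⟨i + 1, by omega, ?_⟩
    rw [iterate_succ_apply, ← e]
    congr 1
    have := hM none
    simp [flip, Store.cfg, Prog.entry, this, Prog.code, ht]
  | @cond_false t p q s u k ht _ ih =>
    intro emb exit hM
    obtain ⟨i, h, e⟩ := ih (fun x => emb (some (Sum.inr x))) exit fun l => hM (some (Sum.inr l))
    refine ⟨i + 1, by omega, ?_⟩
    rw [iterate_succ_apply, ← e]
    congr 1
    have := hM none
    simp [flip, Store.cfg, Prog.entry, this, Prog.code, ht]
  | @loop_done t p s ht =>
    intro emb exit hM
    refine ⟨1, le_rfl, ?_⟩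
    have := hM none
    simp [flip, Store.cfg, Prog.entry, this, Prog.code, ht]
  | @loop_step t p s u w j k ht _ _ ih₁ ih₂ =>
    intro emb exit hM
    -- The exit of the body is the test label, so one pass ends at the head of the same loop.
    obtain ⟨i₁, h₁, e₁⟩ := ih₁ (fun x => emb (some x)) (emb none) fun l => hM (some l)
    obtain ⟨i₂, h₂, e₂⟩ := ih₂ emb exit hM
    refine ⟨i₂ + i₁ + 1, by omega, ?_⟩
    rw [iterate_succ_apply, iterate_add_apply]
    refine Eq.trans (congrArg _ (Eq.trans (congrArg _ ?_) e₁)) e₂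
    have := hM none
    simp [flip, Store.cfg, Prog.entry, this, Prog.code, ht]
  | weaken _ hjk ih =>
    intro emb exit hM
    obtain ⟨i, h, e⟩ := ih emb exit hM
    exact ⟨i, h.trans hjk, e⟩

/-- The machine that runs `p` on its input and then outputs whether `cur` is the bit 1. -/
noncomputable def Prog.machine (p : Prog) : FinTM2 where
  K := Option Reg
  k₀ := some .inp
  k₁ := none
  Γ := Prog.Alphabet
  Λ := Option p.Lab
  main := some p.entry
  σ := Option Γ'
  initialState := none
  Γk₀Fin := inferInstanceAs (Fintype Γ')
  m l := Option.casesOn (motive := fun _ => Prog.Code (Option p.Lab)) l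
    -- A halting configuration must have the register in its initial state, so `cur` is reset after
    -- the answer is written.
    (.push none (fun x => (decide (x = some (.bit true)) : Bool)) (.load (fun _ => none) .halt))
    (p.code some none)

open Classical in
/-- A program that leaves its answer in `cur`, in polynomial time, puts a language in P. -/
theorem InP.of_prog {L : Language Γ'} (p : Prog) (t : Polynomial ℕ)
    (h : ∀ w : List Γ', Run p ⟨none, w, [], [], [], []⟩
      ⟨some (.bit (decide (w ∈ L))), [], [], [], [], []⟩ (t.eval w.length)) : InP L := by
  refine ⟨{ tm := p.machine, inputAlphabet := Equiv.refl Γ', outputAlphabet := Equiv.refl Bool,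
            time := t + 1, outputsFun := fun w => ?_ }⟩
  have hex := (h w).iterate_step (M := p.machine.m) some none fun l => rfl
  let j := hex.choose
  have hj : j ≤ t.eval w.length ∧ _ := hex.choose_spec
  obtain ⟨hj, e⟩ := hj
  -- The additional step executes the output instruction at the label `none`.
  refine ⟨⟨j + 1, ?_⟩, ?_⟩
  · rw [Function.iterate_succ_apply']
    have e0 : (some (initList p.machine (List.map (Equiv.refl Γ').invFun (id w)))) =
        some (Store.cfg ⟨none, w, [], [], [], []⟩ (some p.entry)) := by
      congr 1
      simp only [initList, Store.cfg, Prog.machine]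
      congr 1
      funext k
      rcases k with _ | k
      · rfl
      · cases k
        · exact List.map_id w
        all_goals rfl
    refine (congrArg _ ((congrArg _ e0).trans e)).trans ?_
    refine congrArg some (congrArg (TM2.Cfg.mk none none) ?_)
    funext k
    rcases k with _ | k
    · cases h : decide (w ∈ L) <;> simp [Store.stk, Function.update, encodeBool] <;> rfl
    · cases k <;> rfl
  · simpa using hj

/-! ### Binary trees on stacks: moving, copying, swapping -/

/-- Binary trees with Boolean leaves, the universal data type of stack programs. -/
inductive DTree
  | leaf (x : Bool)
  | node (l r : DTree)

namespace DTree

/-- Prefix notation. -/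
def ser : DTree → List Γ'
  | leaf x => [.bit x]
  | node l r => .comma :: (l.ser ++ r.ser)

def size : DTree → ℕ
  | leaf _ => 1
  | node l r => l.size + r.size + 1

theorem length_ser (d : DTree) : d.ser.length = d.size := by
  induction d with
  | leaf x => rfl
  | node l r hl hr => simp [ser, size, hl, hr]

/-- This leaves `blank` free as an end marker below a stored tree. -/
theorem blank_notMem_ser (d : DTree) : Γ'.blank ∉ d.ser := by
  induction d with
  | leaf x => simp [ser]
  | node l r hl hr => simp [ser, hl, hr]

theorem one_le_size (d : DTree) : 1 ≤ d.size := by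
  cases d <;> simp [size]

end DTree

open DTree

/-- The store in which the stack `c` (for `true`) or `b` (for `false`) is singled out. -/
def Store.side (z : Bool) (v : Option Γ') (i a x y n : List Γ') : Store :=
  bif z then ⟨v, i, a, y, x, n⟩ else ⟨v, i, a, x, y, n⟩

namespace Prog

def sideReg (z : Bool) : Reg := bif z then .c else .b

def pushCur (r : Reg) : Prog := .push r fun v => v.getD .blank

def pushSym (r : Reg) (x : Γ') : Prog := .push r fun _ => x

/-- The stack `n` is a unary counter which, together with the symbol in `cur`, records how many
subtrees remain to be read. A leaf completes one; a `comma` replaces one by two, hence two pushes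
before the pop. Popping the empty counter sets `cur` to `none` and ends the loop. -/
def moveStep (z : Bool) : Prog :=
  .seq (.pop .a) (.seq (pushCur (sideReg z)) (.seq
    (.cond (fun v => v == some .comma) (.seq (pushSym .n .blank) (pushSym .n .blank)) .skip)
    (.pop .n)))

/-- Move the topmost tree of `a`, reversed and preceded by a marker, to another stack. -/
def moveTo (z : Bool) : Prog :=
  .seq (pushSym (sideReg z) .blank) (.seq (pushSym .n .blank) (.seq (.pop .n)
    (.loop Option.isSome (moveStep z))))

/-- Pop symbols up to the next marker and perform `p` for each of them. -/
def pour (r : Reg) (p : Prog) : Prog :=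
  .seq (.pop r) (.loop (fun v => v != some .blank) (.seq p (.pop r)))

def moveFrom (z : Bool) : Prog := pour (sideReg z) (pushCur .a)

def drop : Prog := .seq (moveTo false) (pour .b .skip)

/-- One pass from `b` produces copies on `a` and `c`. The copy on `c` is in reading order and would
arrive on `a` reversed, so it is sent back through `b`. -/
def dup : Prog :=
  .seq (moveTo false) (.seq (pushSym .c .blank) (.seq (pour .b (.seq (pushCur .a) (pushCur .c)))
    (.seq (pushSym .b .blank) (.seq (pour .c (pushCur .b)) (moveFrom false)))))

def swap : Prog :=
  .seq (moveTo false) (.seq (moveTo true) (.seq (moveFrom false) (moveFrom true)))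

def pushList : List Γ' → Prog
  | [] => .skip
  | x :: l => .seq (pushList l) (pushSym .a x)

end Prog

open Prog

/-- Written with the remaining run as a hypothesis, so that the runs over two subtrees chain by
induction. An iteration costs at most 7 steps, attained at a `comma`. -/
theorem run_moveLoop (z : Bool) (d : DTree) : ∀ {i A X Y N : List Γ'} {x : Γ'} {u : Store} {k : ℕ},
    Run (.loop Option.isSome (moveStep z))
      (.side z N.head? i A (d.ser.reverse ++ X) Y N.tail) u k →
    Run (.loop Option.isSome (moveStep z)) (.side z (some x) i (d.ser ++ A) X Y N) u
      (k + 7 * d.size) := by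
  induction d with
  | leaf y =>
    intro i A X Y N x u k h
    cases z
    all_goals
      exact Run.weaken (Run.loop_step rfl (Run.seq (Run.pop _ _) (Run.seq (Run.push _ _ _)
        (Run.seq (Run.cond_false rfl (Run.skip _)) (Run.pop _ _)))) h) (by simp only [size]; omega)
  | node l r hl hr =>
    intro i A X Y N x u k h
    -- While the left subtree is read, the counter holds one more `blank` for the pending right
    -- subtree.
    have h' := @hl i (r.ser ++ A) (.comma :: X) Y (.blank :: N) .blank u _
      (@hr i A (l.ser.reverse ++ .comma :: X) Y N .blank u k
      (by simpa only [ser, List.reverse_cons, List.reverse_append, List.append_assoc,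
        List.cons_append, List.nil_append] using h))
    simp only [ser, List.cons_append, List.append_assoc]
    cases z
    all_goals
      exact Run.weaken (Run.loop_step rfl (Run.seq (Run.pop _ _) (Run.seq (Run.push _ _ _)
        (Run.seq (Run.cond_true rfl (Run.seq (Run.push _ _ _) (Run.push _ _ _))) (Run.pop _ _)))) h')
          (by simp only [size]; omega)

theorem run_moveTo (z : Bool) (d : DTree) (v : Option Γ') (i A X Y : List Γ') :
    Run (moveTo z) (.side z v i (d.ser ++ A) X Y [])
      (.side z none i A (d.ser.reverse ++ .blank :: X) Y []) (7 * d.size + 4) := by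
  have h := run_moveLoop z d (i := i) (A := A) (X := .blank :: X) (Y := Y) (N := []) (x := .blank)
    (Run.loop_done (by cases z <;> rfl))
  cases z
  all_goals
    exact Run.weaken (Run.seq (Run.push _ _ _) (Run.seq (Run.push _ _ _) (Run.seq (Run.pop _ _) h)))
      (by omega)

theorem ne_blank_of_notMem {x : Γ'} {l : List Γ'} (h : Γ'.blank ∉ x :: l) :
    (some x != some Γ'.blank) = true := by
  simp only [List.mem_cons, not_or] at h
  simpa using fun e => h.1 e.symm

theorem run_moveFrom (z : Bool) (w : List Γ') : ∀ (v : Option Γ') (i A X Y N : List Γ'),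
    Γ'.blank ∉ w → Run (moveFrom z) (.side z v i A (w ++ .blank :: X) Y N)
      (.side z (some .blank) i (w.reverse ++ A) X Y N) (3 * w.length + 2) := by
  -- At the head of the loop the next symbol has already been popped into `cur`.
  suffices H : ∀ (i A X Y N : List Γ'), Γ'.blank ∉ w →
      Run (.loop (fun v => v != some .blank) (.seq (pushCur .a) (.pop (sideReg z))))
        (.side z (w ++ .blank :: X).head? i A (w ++ .blank :: X).tail Y N)
      (.side z (some .blank) i (w.reverse ++ A) X Y N) (3 * w.length + 1) by
    intro v i A X Y N hw
    have := H i A X Y N hw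
    cases z
    all_goals exact Run.weaken (Run.seq (Run.pop _ _) this) (by omega)
  induction w with
  | nil =>
    intro i A X Y N _
    cases z
    all_goals exact Run.loop_done rfl
  | cons x w ih =>
    intro i A X Y N hw
    have h := ih i (x :: A) X Y N fun h => hw (List.mem_cons_of_mem _ h)
    have hx := ne_blank_of_notMem hw
    simp only [List.reverse_cons, List.append_assoc, List.cons_append, List.nil_append]
    cases z
    all_goals
      exact Run.weaken (Run.loop_step hx (Run.seq (Run.push _ _ _) (Run.pop _ _)) h)
        (by simp only [List.length_cons]; omega)

theorem run_pour_skip (w : List Γ') : ∀ (v : Option Γ') (i A B C N : List Γ'),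
    Γ'.blank ∉ w → Run (pour .b .skip) ⟨v, i, A, w ++ .blank :: B, C, N⟩
      ⟨some .blank, i, A, B, C, N⟩ (3 * w.length + 2) := by
  suffices H : ∀ (i A B C N : List Γ'), Γ'.blank ∉ w →
      Run (.loop (fun v => v != some .blank) (.seq .skip (.pop .b)))
        ⟨(w ++ .blank :: B).head?, i, A, (w ++ .blank :: B).tail, C, N⟩
      ⟨some .blank, i, A, B, C, N⟩ (3 * w.length + 1) by
    intro v i A B C N hw
    exact Run.weaken (Run.seq (Run.pop _ _) (H i A B C N hw)) (by omega)
  induction w with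
  | nil =>
    intro i A B C N _
    exact Run.loop_done rfl
  | cons x w ih =>
    intro i A B C N hw
    exact Run.weaken (Run.loop_step (ne_blank_of_notMem hw) (Run.seq (Run.skip _) (Run.pop _ _))
      (ih i A B C N fun h => hw (List.mem_cons_of_mem _ h)))
        (by simp only [List.length_cons]; omega)

theorem run_pour_two (w : List Γ') : ∀ (v : Option Γ') (i A B C N : List Γ'),
    Γ'.blank ∉ w → Run (pour .b (.seq (pushCur .a) (pushCur .c)))
      ⟨v, i, A, w ++ .blank :: B, C, N⟩
      ⟨some .blank, i, w.reverse ++ A, B, w.reverse ++ C, N⟩ (4 * w.length + 2) := by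
  suffices H : ∀ (i A B C N : List Γ'), Γ'.blank ∉ w →
      Run (.loop (fun v => v != some .blank) (.seq (.seq (pushCur .a) (pushCur .c)) (.pop .b)))
        ⟨(w ++ .blank :: B).head?, i, A, (w ++ .blank :: B).tail, C, N⟩
      ⟨some .blank, i, w.reverse ++ A, B, w.reverse ++ C, N⟩ (4 * w.length + 1) by
    intro v i A B C N hw
    exact Run.weaken (Run.seq (Run.pop _ _) (H i A B C N hw)) (by omega)
  induction w with
  | nil =>
    intro i A B C N _
    exact Run.loop_done rfl
  | cons x w ih =>
    intro i A B C N hw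
    simp only [List.reverse_cons, List.append_assoc, List.cons_append, List.nil_append]
    exact Run.weaken (Run.loop_step (ne_blank_of_notMem hw)
      (Run.seq (Run.seq (Run.push _ _ _) (Run.push _ _ _)) (Run.pop _ _))
      (ih i (x :: A) B (x :: C) N fun h => hw (List.mem_cons_of_mem _ h)))
        (by simp only [List.length_cons]; omega)

theorem run_pour_back (w : List Γ') : ∀ (v : Option Γ') (i A B C N : List Γ'),
    Γ'.blank ∉ w → Run (pour .c (pushCur .b)) ⟨v, i, A, B, w ++ .blank :: C, N⟩
      ⟨some .blank, i, A, w.reverse ++ B, C, N⟩ (3 * w.length + 2) := by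
  suffices H : ∀ (i A B C N : List Γ'), Γ'.blank ∉ w →
      Run (.loop (fun v => v != some .blank) (.seq (pushCur .b) (.pop .c)))
        ⟨(w ++ .blank :: C).head?, i, A, B, (w ++ .blank :: C).tail, N⟩
      ⟨some .blank, i, A, w.reverse ++ B, C, N⟩ (3 * w.length + 1) by
    intro v i A B C N hw
    exact Run.weaken (Run.seq (Run.pop _ _) (H i A B C N hw)) (by omega)
  induction w with
  | nil =>
    intro i A B C N _
    exact Run.loop_done rfl
  | cons x w ih =>
    intro i A B C N hw
    simp only [List.reverse_cons, List.append_assoc, List.cons_append, List.nil_append]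
    exact Run.weaken (Run.loop_step (ne_blank_of_notMem hw) (Run.seq (Run.push _ _ _) (Run.pop _ _))
      (ih i A (x :: B) C N fun h => hw (List.mem_cons_of_mem _ h)))
        (by simp only [List.length_cons]; omega)

theorem run_moveFrom_ser (z : Bool) (d : DTree) (v : Option Γ') (i A X Y N : List Γ') :
    Run (moveFrom z) (.side z v i A (d.ser.reverse ++ .blank :: X) Y N)
      (.side z (some .blank) i (d.ser ++ A) X Y N) (3 * d.size + 2) := by
  simpa [length_ser] using run_moveFrom z d.ser.reverse v i A X Y N
    (by simpa using d.blank_notMem_ser)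

theorem run_drop (d : DTree) (v : Option Γ') (i A B C : List Γ') :
    Run drop ⟨v, i, d.ser ++ A, B, C, []⟩ ⟨some .blank, i, A, B, C, []⟩ (10 * d.size + 6) := by
  have h := run_pour_skip d.ser.reverse none i A B C [] (by simpa using d.blank_notMem_ser)
  refine Run.weaken (Run.seq (run_moveTo false d v i A B C) h) ?_
  simp only [List.length_reverse, length_ser]
  omega

theorem run_dup (d : DTree) (v : Option Γ') (i A B C : List Γ') :
    Run dup ⟨v, i, d.ser ++ A, B, C, []⟩ ⟨some .blank, i, d.ser ++ (d.ser ++ A), B, C, []⟩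
      (17 * d.size + 12) := by
  have h₁ := run_pour_two d.ser.reverse none i A B (.blank :: C) [] (by simpa using d.blank_notMem_ser)
  have h₂ := run_pour_back d.ser (some .blank) i (d.ser ++ A) (.blank :: B) C []
    d.blank_notMem_ser
  rw [List.reverse_reverse] at h₁
  refine Run.weaken (Run.seq (run_moveTo false d v i A B C) (Run.seq (Run.push _ _ _)
    (Run.seq h₁ (Run.seq (Run.push _ _ _) (Run.seq h₂
      (run_moveFrom_ser false d (some .blank) i (d.ser ++ A) B C [])))))) ?_
  simp only [List.length_reverse, length_ser]
  omega

theorem run_swap (d e : DTree) (v : Option Γ') (i A B C : List Γ') :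
    Run swap ⟨v, i, d.ser ++ (e.ser ++ A), B, C, []⟩
      ⟨some .blank, i, e.ser ++ (d.ser ++ A), B, C, []⟩ (10 * (d.size + e.size) + 12) := by
  refine Run.weaken (Run.seq (run_moveTo false d v i _ B C) (Run.seq
    (run_moveTo true e none i A C _) (Run.seq
      (run_moveFrom_ser false d none i A B (e.ser.reverse ++ .blank :: C) [])
      (run_moveFrom_ser true e (some .blank) i (d.ser ++ A) C B [])))) ?_
  omega

theorem run_pushList (l : List Γ') (v : Option Γ') (i A B C N : List Γ') :
    Run (pushList l) ⟨v, i, A, B, C, N⟩ ⟨v, i, l ++ A, B, C, N⟩ (l.length + 1) := by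
  induction l with
  | nil => exact Run.skip _
  | cons x l ih => exact Run.weaken (Run.seq ih (Run.push _ _ _)) (by simp)

/-- Replace a list and a state on the stack `a` by the result of a left fold, where `p` replaces an
entry and a state by the next state. -/
def Prog.foldLoop (p : Prog) : Prog :=
  -- A nonempty list begins with `comma`, the empty one with a bit. The entry goes to `b` and the
  -- tail to `c`; the entry then returns, and a `comma` joins it with the state into the pair on
  -- which `p` acts. Finally the tail returns and its first symbol is popped for the next test.
  .loop (fun v => v == some .comma) (.seq (moveTo false) (.seq (moveTo true) (.seq (moveFrom false)
    (.seq (pushSym .a .comma) (.seq p (.seq (moveFrom true) (.pop .a)))))))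

/-! ### Encodings and the class of polynomial-time functions -/

/-- Types whose elements can be written as binary trees. -/
class Enc (α : Type) where
  enc : α → DTree

open Enc

instance : Enc Bool := ⟨leaf⟩

instance {α β : Type} [Enc α] [Enc β] : Enc (α × β) := ⟨fun x => node (enc x.1) (enc x.2)⟩

def encList {α : Type} [Enc α] : List α → DTree
  | [] => leaf false
  | x :: l => node (enc x) (encList l)

instance {α : Type} [Enc α] : Enc (List α) := ⟨encList⟩

/-- The size of the tree that represents `x`. -/
def esize {α : Type} [Enc α] (x : α) : ℕ := (enc x).size

section esize

variable {α β : Type} [Enc α] [Enc β]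

@[simp] theorem esize_bool (x : Bool) : esize x = 1 := rfl

@[simp] theorem esize_prod (x : α × β) : esize x = esize x.1 + esize x.2 + 1 := rfl

@[simp] theorem esize_nil : esize ([] : List α) = 1 := rfl

@[simp] theorem esize_cons (x : α) (l : List α) : esize (x :: l) = esize x + esize l + 1 := rfl

theorem one_le_esize (x : α) : 1 ≤ esize x := one_le_size _

theorem length_lt_esize (l : List α) : l.length < esize l := by
  induction l with
  | nil => simp
  | cons x l ih => simp only [List.length_cons, esize_cons]; omega

theorem esize_le_of_mem {x : α} {l : List α} (h : x ∈ l) : esize x ≤ esize l := by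
  induction l with
  | nil => simp at h
  | cons y l ih =>
    rcases List.mem_cons.1 h with rfl | h
    · simp only [esize_cons]; omega
    · have := ih h
      simp only [esize_cons]; omega

end esize

theorem Polynomial.eval_nat_mono (p : Polynomial ℕ) : Monotone fun k => p.eval k := by
  intro j k h
  induction p using Polynomial.induction_on' with
  | add p q hp hq => simpa using add_le_add hp hq
  | monomial n a => simpa using Nat.mul_le_mul_left a (Nat.pow_le_pow_left h n)

/-- `f` is bounded by a polynomial in the size of its argument. -/
def PolyBounded {α : Type} [Enc α] (f : α → ℕ) : Prop :=
  ∃ p : Polynomial ℕ, ∀ x, f x ≤ p.eval (esize x)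

namespace PolyBounded

variable {α : Type} [Enc α] {f g : α → ℕ}

theorem mono (hg : PolyBounded g) (h : ∀ x, f x ≤ g x) : PolyBounded f :=
  hg.imp fun _ hp x => (h x).trans (hp x)

theorem const (k : ℕ) : PolyBounded fun _ : α => k := ⟨Polynomial.C k, fun x => by simp⟩

theorem esize : PolyBounded fun x : α => esize x := ⟨Polynomial.X, fun x => by simp⟩

theorem add (hf : PolyBounded f) (hg : PolyBounded g) : PolyBounded fun x => f x + g x := by
  obtain ⟨p, hp⟩ := hf
  obtain ⟨q, hq⟩ := hg
  exact ⟨p + q, fun x => by simpa using add_le_add (hp x) (hq x)⟩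

theorem mul (hf : PolyBounded f) (hg : PolyBounded g) : PolyBounded fun x => f x * g x := by
  obtain ⟨p, hp⟩ := hf
  obtain ⟨q, hq⟩ := hg
  exact ⟨p * q, fun x => by simpa using Nat.mul_le_mul (hp x) (hq x)⟩

theorem eval (p : Polynomial ℕ) (hf : PolyBounded f) : PolyBounded fun x => p.eval (f x) := by
  obtain ⟨q, hq⟩ := hf
  exact ⟨p.comp q, fun x => by simpa using p.eval_nat_mono (hq x)⟩

end PolyBounded

/-- `P` replaces the topmost tree `d` of the stack `a` by `e` in at most `k` steps. -/
def Computes (P : Prog) (d e : DTree) (k : ℕ) : Prop :=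
  ∀ (v : Option Γ') (i A B C : List Γ'),
    ∃ v', Run P ⟨v, i, d.ser ++ A, B, C, []⟩ ⟨v', i, e.ser ++ A, B, C, []⟩ k

/-- Functions computed by stack programs in polynomial time. -/
def PolyTime {α β : Type} [Enc α] [Enc β] (f : α → β) : Prop :=
  PolyBounded (fun x => esize (f x)) ∧
    ∃ (P : Prog) (t : α → ℕ), PolyBounded t ∧ ∀ x, Computes P (enc x) (enc (f x)) (t x)

namespace PolyTime

variable {α β γ δ σ : Type} [Enc α] [Enc β] [Enc γ] [Enc δ] [Enc σ]

theorem id : PolyTime fun x : α => x :=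
  ⟨.esize, .skip, fun _ => 1, .const 1, fun _ v _ _ _ _ => ⟨v, Run.skip _⟩⟩

theorem const (b : β) : PolyTime fun _ : α => b := by
  refine ⟨.const _, .seq drop (pushList (enc b).ser), _,
    ((PolyBounded.const 10).mul .esize |>.add (.const 6)).add (.const ((enc b).ser.length + 1)),
    fun x v i A B C => ⟨some .blank, Run.seq (run_drop _ _ _ _ _ _) (run_pushList _ _ _ _ _ _ _)⟩⟩

theorem _root_.PolyBounded.comp {g : β → ℕ} {f : α → β} (hg : PolyBounded g) (hf : PolyTime f) :
    PolyBounded fun x => g (f x) := by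
  obtain ⟨p, hp⟩ := hg
  exact (hf.1.eval p).mono fun x => hp (f x)

/-- The size bound contained in `PolyTime f` is what makes the running time of the second program
polynomial in the original input. -/
theorem comp {g : β → γ} {f : α → β} (hg : PolyTime g) (hf : PolyTime f) :
    PolyTime fun x => g (f x) := by
  obtain ⟨P, s, hs, hP⟩ := hf.2
  obtain ⟨Q, t, ht, hQ⟩ := hg.2
  refine ⟨hg.1.comp hf, .seq P Q, _, hs.add (ht.comp hf), fun x v i A B C => ?_⟩
  obtain ⟨v₁, h₁⟩ := hP x v i A B C
  obtain ⟨v₂, h₂⟩ := hQ (f x) v₁ i A B C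
  exact ⟨v₂, Run.seq h₁ h₂⟩

/-- Programs only see trees, so a change of type that preserves the tree is free: pairs become list
cells, bit lists become numbers. -/
theorem of_enc_eq {f : α → β} {g : α → γ} (hf : PolyTime f) (h : ∀ x, enc (f x) = enc (g x)) :
    PolyTime g := by
  obtain ⟨hb, P, s, hs, hP⟩ := hf
  exact ⟨hb.mono fun x => by rw [esize, esize, h], P, s, hs, fun x => h x ▸ hP x⟩

theorem pair {f : α → β} {g : α → γ} (hf : PolyTime f) (hg : PolyTime g) :
    PolyTime fun x => (f x, g x) := by
  obtain ⟨P, s, hs, hP⟩ := hf.2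
  obtain ⟨Q, t, ht, hQ⟩ := hg.2
  refine ⟨(hf.1.add hg.1).add (.const 1),
    .seq dup (.seq Q (.seq swap (.seq P (pushSym .a .comma)))), _,
    (((PolyBounded.const 17).mul .esize).add (.const 12)).add (ht.add
      ((((PolyBounded.const 10).mul (hg.1.add .esize)).add (.const 12)).add (hs.add (.const 1)))),
    fun x v i A B C => ?_⟩
  obtain ⟨v₁, h₁⟩ := hQ x (some .blank) i ((enc x).ser ++ A) B C
  obtain ⟨v₂, h₂⟩ := hP x (some .blank) i ((enc (g x)).ser ++ A) B C
  have h := Run.seq (run_dup (enc x) v i A B C) (Run.seq h₁ (Run.seq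
    (run_swap (enc (g x)) (enc x) v₁ i A B C) (Run.seq h₂ (Run.push .a (fun _ => .comma) _))))
  refine ⟨v₂, ?_⟩
  rw [show (enc (f x, g x)).ser ++ A = .comma :: ((enc (f x)).ser ++ ((enc (g x)).ser ++ A)) by
    simp [enc, ser]]
  exact h

theorem fst : PolyTime fun x : α × β => x.1 := by
  refine ⟨.mono .esize fun x => by simp only [esize_prod]; omega,
    .seq (.pop .a) (.seq swap drop), _,
    ((PolyBounded.const 20).mul .esize).add (.const 30), fun x v i A B C => ⟨some .blank, ?_⟩⟩
  have h := Run.seq (Run.pop .a ⟨v, i, .comma :: ((enc x.1).ser ++ ((enc x.2).ser ++ A)), B, C, []⟩)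
    (Run.seq (run_swap (enc x.1) (enc x.2) (some .comma) i A B C)
      (run_drop (enc x.2) (some .blank) i ((enc x.1).ser ++ A) B C))
  rw [show (enc x).ser ++ A = .comma :: ((enc x.1).ser ++ ((enc x.2).ser ++ A)) by
    simp [enc, ser]]
  have e : (enc x).size = (enc x.1).size + (enc x.2).size + 1 := rfl
  refine h.weaken ?_
  simp only [esize]
  omega

theorem snd : PolyTime fun x : α × β => x.2 := by
  refine ⟨.mono .esize fun x => by simp only [esize_prod]; omega,
    .seq (.pop .a) drop, _,
    ((PolyBounded.const 20).mul .esize).add (.const 30), fun x v i A B C => ⟨some .blank, ?_⟩⟩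
  have h := Run.seq (Run.pop .a ⟨v, i, .comma :: ((enc x.1).ser ++ ((enc x.2).ser ++ A)), B, C, []⟩)
    (run_drop (enc x.1) (some .comma) i ((enc x.2).ser ++ A) B C)
  rw [show (enc x).ser ++ A = .comma :: ((enc x.1).ser ++ ((enc x.2).ser ++ A)) by
    simp [enc, ser]]
  have e : (enc x).size = (enc x.1).size + (enc x.2).size + 1 := rfl
  refine h.weaken ?_
  simp only [esize]
  omega

theorem cond {c : α → Bool} {f g : α → β} (hc : PolyTime c) (hf : PolyTime f) (hg : PolyTime g) :
    PolyTime fun x => bif c x then f x else g x := by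
  obtain ⟨R, r, hr, hR⟩ := hc.2
  obtain ⟨P, s, hs, hP⟩ := hf.2
  obtain ⟨Q, t, ht, hQ⟩ := hg.2
  refine ⟨(hf.1.add hg.1).mono fun x => by dsimp only; cases c x <;> simp,
    .seq dup (.seq R (.seq (.pop .a) (.cond (fun v => v == some (.bit true)) P Q))), _,
    (((PolyBounded.const 17).mul .esize).add (.const 12)).add (hr.add ((PolyBounded.const 1).add
      ((hs.add ht).add (.const 1)))), fun x v i A B C => ?_⟩
  obtain ⟨v₁, h₁⟩ := hR x (some .blank) i ((enc x).ser ++ A) B C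
  dsimp only
  cases h : c x
  · obtain ⟨v₂, h₂⟩ := hQ x (some (.bit false)) i A B C
    rw [h] at h₁
    exact ⟨v₂, Run.seq (run_dup _ _ _ _ _ _) (Run.seq h₁ (Run.seq (Run.pop _ _)
      (Run.cond_false rfl (h₂.weaken (by omega)))))⟩
  · obtain ⟨v₂, h₂⟩ := hP x (some (.bit true)) i A B C
    rw [h] at h₁
    exact ⟨v₂, Run.seq (run_dup _ _ _ _ _ _) (Run.seq h₁ (Run.seq (Run.pop _ _)
      (Run.cond_true rfl (h₂.weaken (by omega)))))⟩

theorem cons {f : α → β} {g : α → List β} (hf : PolyTime f) (hg : PolyTime g) :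
    PolyTime fun x => f x :: g x :=
  (hf.pair hg).of_enc_eq fun _ => rfl

theorem listCases {l : α → List β} {g : α → γ} {h : (β × List β) × α → γ} (hl : PolyTime l)
    (hg : PolyTime g) (hh : PolyTime h) :
    PolyTime fun x => List.casesOn (motive := fun _ => γ) (l x) (g x) fun b t => h ((b, t), x) := by
  obtain ⟨R, r, hr, hR⟩ := hl.2
  obtain ⟨P, s, hs, hP⟩ := hg.2
  obtain ⟨q, hq⟩ := hh.1
  obtain ⟨Q, t, ⟨p, hp⟩, hQ⟩ := hh.2
  have hsz : PolyBounded fun x => esize (l x) + esize x + 1 := (hl.1.add .esize).add (.const 1)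
  refine ⟨(hg.1.add (hsz.eval q)).mono fun x => ?_,
    .seq dup (.seq R (.seq (.pop .a) (.cond (fun v => v == some .comma)
      -- One `comma` restores the popped head of the list cell, the other pairs the cell with the
      -- saved input.
      (.seq (pushSym .a .comma) (.seq (pushSym .a .comma) Q)) P))), _,
    (((PolyBounded.const 17).mul .esize).add (.const 12)).add (hr.add ((PolyBounded.const 1).add
      ((hs.add ((PolyBounded.const 2).add (hsz.eval p))).add (.const 1)))), fun x v i A B C => ?_⟩
  · dsimp only
    rcases e : l x with _ | ⟨b, t⟩
    · simp
    · exact (hq ((b, t), x)).trans (le_add_left (q.eval_nat_mono (by simp)))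
  · obtain ⟨v₁, h₁⟩ := hR x (some .blank) i ((enc x).ser ++ A) B C
    dsimp only
    rcases e : l x with _ | ⟨b, t⟩
    · obtain ⟨v₂, h₂⟩ := hP x (some (.bit false)) i A B C
      rw [e] at h₁
      exact ⟨v₂, Run.seq (run_dup _ _ _ _ _ _) (Run.seq h₁ (Run.seq (Run.pop _ _)
        (Run.cond_false rfl (h₂.weaken (by omega)))))⟩
    · obtain ⟨v₂, h₂⟩ := hQ ((b, t), x) (some .comma) i A B C
      have hp' := hp ((b, t), x)
      simp only [enc, ser, List.cons_append, List.append_assoc] at h₁ h₂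
      rw [e] at h₁
      simp only [encList, ser, List.cons_append, List.append_assoc] at h₁ h₂
      simp only [esize_prod, esize_cons] at hp' ⊢
      exact ⟨v₂, Run.seq (run_dup _ _ _ _ _ _) (Run.seq h₁ (Run.seq (Run.pop _ _)
        (Run.cond_true rfl (Run.weaken (Run.seq (Run.push _ _ _) (Run.seq (Run.push _ _ _) h₂))
          (by omega)))))⟩

/-- The loop of `foldl`, started after the first symbol of the list has been popped. -/
theorem run_foldLoop {step : β × σ → σ} {P : Prog} {t : β × σ → ℕ} {p : Polynomial ℕ}
    (hp : ∀ x, t x ≤ p.eval (esize x))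
    (hP : ∀ x, Computes P (enc x) (enc (step x)) (t x)) (M : ℕ) (i A B C : List Γ') (l : List β) :
    ∀ s : σ, esize l ≤ M →
      (∀ k, k <+: l → esize (k.foldl (fun s b => step (b, s)) s) ≤ M) →
      ∃ v, Run (foldLoop P)
        ⟨((enc l).ser ++ ((enc s).ser ++ A)).head?, i, ((enc l).ser ++ ((enc s).ser ++ A)).tail,
          B, C, []⟩
        ⟨v, i, (enc (l.foldl (fun s b => step (b, s)) s)).ser ++ A, B, C, []⟩
        (l.length * (20 * M + 15 + p.eval (2 * M + 1)) + 1) := by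
  induction l with
  | nil =>
    intro s _ _
    exact ⟨some (.bit false), Run.weaken (Run.loop_done rfl) (by simp)⟩
  | cons b l ih =>
    intro s hl hM
    have hs : esize s ≤ M := hM [] (by simp)
    simp only [esize_cons] at hl
    obtain ⟨v₂, h₂⟩ := ih (step (b, s)) (by omega) fun k hk => hM (b :: k) (by simpa using hk)
    obtain ⟨v₁, h₁⟩ := hP (b, s) (some .blank) i A B ((enc l).ser.reverse ++ .blank :: C)
    -- Entry and state have size at most `M` each, and pairing adds one node.
    have ht : t (b, s) ≤ p.eval (2 * M + 1) :=
      (hp _).trans (p.eval_nat_mono (by simp only [esize_prod]; omega))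
    have e : (enc (b :: l)).ser ++ ((enc s).ser ++ A) =
        .comma :: ((enc b).ser ++ ((enc l).ser ++ ((enc s).ser ++ A))) := by
      simp [enc, encList, ser]
    have e' : (enc (b, s)).ser ++ A = .comma :: ((enc b).ser ++ ((enc s).ser ++ A)) := by
      simp [enc, ser]
    rw [e'] at h₁
    rw [e]
    refine ⟨v₂, Run.weaken (Run.loop_step rfl (Run.seq (run_moveTo false (enc b) _ i _ B C) (Run.seq
      (run_moveTo true (enc l) none i ((enc s).ser ++ A) C _)
      (Run.seq (run_moveFrom_ser false (enc b) none i _ B _ [])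
        (Run.seq (Run.push _ _ _) (Run.seq h₁ (Run.seq
          (run_moveFrom_ser true (enc l) v₁ i ((enc (step (b, s))).ser ++ A) C B [])
            (Run.pop _ _))))))) h₂) ?_⟩
    simp only [List.length_cons, esize] at hl ⊢
    rw [Nat.add_mul]
    omega

theorem foldl_aux {l : α → List β} {s : α → σ} {step : β × σ → σ} (hl : PolyTime l)
    (hs : PolyTime s) (hstep : PolyTime step) {m : α → ℕ} (hm : PolyBounded m)
    (h : ∀ x k, k <+: l x → esize (k.foldl (fun s b => step (b, s)) (s x)) ≤ m x) :
    PolyTime fun x => (l x).foldl (fun s b => step (b, s)) (s x) := by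
  obtain ⟨R, r, hr, hR⟩ := (hl.pair hs).2
  obtain ⟨P, t, ⟨p, hp⟩, hP⟩ := hstep.2
  have hM : PolyBounded fun x => esize (l x) + m x := hl.1.add hm
  refine ⟨hm.mono fun x => h x _ List.prefix_rfl, .seq R (.seq (.pop .a) (.seq (.pop .a) (foldLoop P))), _,
    hr.add ((PolyBounded.const 2).add ((hl.1.mul ((((PolyBounded.const 20).mul hM).add
      (.const 15)).add ((((PolyBounded.const 2).mul hM).add (.const 1)).eval p))).add (.const 1))),
    fun x v i A B C => ?_⟩
  · obtain ⟨v₁, h₁⟩ := hR x v i A B C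
    obtain ⟨v₂, h₂⟩ := run_foldLoop hp hP (esize (l x) + m x) i A B C (l x) (s x) (by omega)
      fun k hk => (h x k hk).trans (by omega)
    have e : (enc (l x, s x)).ser ++ A =
        .comma :: ((enc (l x)).ser ++ ((enc (s x)).ser ++ A)) := by
      simp [enc, ser]
    rw [e] at h₁
    refine ⟨v₂, Run.weaken (Run.seq h₁ (Run.seq (Run.pop _ _) (Run.seq (Run.pop _ _) h₂))) ?_⟩
    have := length_lt_esize (l x)
    have := Nat.mul_le_mul_right (20 * (esize (l x) + m x) + 15 +
      p.eval (2 * (esize (l x) + m x) + 1)) this.le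
    omega

/-- Polynomial time functions are closed under iteration along a list, as long as the size of the
intermediate results is polynomially bounded. -/
theorem foldl {l : α → List β} {s : α → σ} {step : α × β × σ → σ} (hl : PolyTime l)
    (hs : PolyTime s) (hstep : PolyTime step) {m : α → ℕ} (hm : PolyBounded m)
    (h : ∀ x k, k <+: l x → esize (k.foldl (fun s b => step (x, b, s)) (s x)) ≤ m x) :
    PolyTime fun x => (l x).foldl (fun s b => step (x, b, s)) (s x) := by
  -- In `foldl_aux` the step cannot see the input; it is therefore carried unchanged as the first
  -- component of the state.
  have key : ∀ (k : List β) (x : α) (s : σ),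
      k.foldl (fun s b => (s.1, step (s.1, b, s.2))) (x, s) =
        (x, k.foldl (fun s b => step (x, b, s)) s) := by
    intro k x
    induction k with
    | nil => intro s; rfl
    | cons b k ih => intro s; exact ih _
  have H := foldl_aux (s := fun x => (x, s x)) (step := fun y : β × α × σ =>
    (y.2.1, step (y.2.1, y.1, y.2.2))) hl (id.pair hs)
    ((fst.comp snd).pair (hstep.comp ((fst.comp snd).pair (fst.pair (snd.comp snd)))))
    ((PolyBounded.esize.add hm).add (.const 1)) fun x k hk => by
      have := h x k hk
      simp only [key, esize_prod]
      omega
  simp only [key] at H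
  exact snd.comp H

end PolyTime

/-! ### From polynomial-time functions to languages in P -/

/-- The input of a decision algorithm: the symbols of the input string, where the second entry is
the bit and the first tells whether the symbol is a bit at all. -/
def symbolCode : Γ' → Bool × Bool
  | .bit x => (true, x)
  | _ => (false, false)

/-- Starting from the empty list, each symbol is put in front of the list as a pair of bits. The two
`comma`s open the list cell and the pair, and are pushed last because the stack is read from the
top. The input thus ends up reversed. -/
def Prog.readInput : Prog :=
  .seq (pushSym .a (.bit false)) (.seq (.pop .inp) (.loop Option.isSome
    (.seq (.push .a fun v => .bit (symbolCode (v.getD .blank)).2)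
      (.seq (.push .a fun v => .bit (symbolCode (v.getD .blank)).1)
        (.seq (pushSym .a .comma) (.seq (pushSym .a .comma) (.pop .inp)))))))

theorem run_readInput (w : List Γ') :
    Run readInput ⟨none, w, [], [], [], []⟩
      ⟨none, [], (enc (w.map symbolCode).reverse).ser ++ [], [], [], []⟩ (6 * w.length + 3) := by
  suffices H : ∀ (w : List Γ') (l : List (Bool × Bool)),
      Run (.loop Option.isSome
        (.seq (.push .a fun v => .bit (symbolCode (v.getD .blank)).2)
          (.seq (.push .a fun v => .bit (symbolCode (v.getD .blank)).1)
            (.seq (pushSym .a .comma) (.seq (pushSym .a .comma) (.pop .inp))))))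
        ⟨w.head?, w.tail, (enc l).ser, [], [], []⟩
        ⟨none, [], (enc ((w.map symbolCode).reverse ++ l)).ser, [], [], []⟩ (6 * w.length + 1) by
    have h := H w []
    simp only [List.append_nil] at h ⊢
    exact Run.weaken (Run.seq (Run.push _ _ _) (Run.seq (Run.pop _ _) h)) (by omega)
  intro w
  induction w with
  | nil => intro l; exact Run.loop_done rfl
  | cons x w ih =>
    intro l
    have h := ih (symbolCode x :: l)
    simp only [List.map_cons, List.reverse_cons, List.append_assoc, List.cons_append,
      List.nil_append]
    exact Run.weaken (Run.loop_step rfl (Run.seq (Run.push _ _ _) (Run.seq (Run.push _ _ _)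
      (Run.seq (Run.push _ _ _) (Run.seq (Run.push _ _ _) (Run.pop _ _))))) h)
        (by simp only [List.length_cons]; omega)

theorem esize_symbols (l : List (Bool × Bool)) : esize l = 4 * l.length + 1 := by
  induction l with
  | nil => rfl
  | cons x l ih => simp [ih]; omega

/-- The language decided by `f`, which is given the symbols of the input in reverse order. -/
def decidedLanguage (f : List (Bool × Bool) → Bool) : Language Γ' :=
  {w | f (w.map symbolCode).reverse = true}

theorem mem_decidedLanguage {f : List (Bool × Bool) → Bool} {w : List Γ'} :
    w ∈ decidedLanguage f ↔ f (w.map symbolCode).reverse = true := Iff.rfl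

theorem InP.of_polyTime {f : List (Bool × Bool) → Bool} (hf : PolyTime f) :
    InP (decidedLanguage f) := by
  obtain ⟨P, t, ⟨p, hp⟩, hP⟩ := hf.2
  refine InP.of_prog (.seq readInput (.seq P (.pop .a)))
    -- Reading costs `6 * X + 3` steps, the list of symbols is a tree of size `4 * X + 1`, and the
    -- last step pops the answer.
    ((6 * Polynomial.X + 3) + p.comp (4 * Polynomial.X + 1) + 1) fun w => ?_
  obtain ⟨v, h⟩ := hP (w.map symbolCode).reverse none [] [] [] []
  have e : ∀ _ : Decidable (w ∈ decidedLanguage f),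
      decide (w ∈ decidedLanguage f) = f (w.map symbolCode).reverse := fun _ => by
    rw [Bool.eq_iff_iff, decide_eq_true_eq, mem_decidedLanguage]
  have hb := hp (w.map symbolCode).reverse
  rw [esize_symbols, List.length_reverse, List.length_map] at hb
  rw [e]
  refine Run.weaken (Run.seq (run_readInput w) (Run.seq h (Run.pop .a _))) ?_
  simp only [Polynomial.eval_add, Polynomial.eval_mul, Polynomial.eval_comp, Polynomial.eval_X,
    Polynomial.eval_ofNat, Polynomial.eval_one]
  omega

theorem List.foldl_or_eq_any {β : Type} (c : β → Bool) (l : List β) (a : Bool) :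
    l.foldl (fun s b => s || c b) a = (a || l.any c) := by
  induction l generalizing a with
  | nil => simp
  | cons b l ih => rw [List.foldl_cons, ih, List.any_cons, Bool.or_assoc]

/-! ### Bounded iteration and Boolean operations -/

namespace PolyTime

variable {α β γ δ σ : Type} [Enc α] [Enc β] [Enc γ] [Enc δ] [Enc σ]

/-- Iteration along a list, if each step increases some upper bound of the size by at most a
polynomially bounded amount. -/
theorem foldl_of_measure {l : α → List β} {s : α → σ} {step : α → β → σ → σ} (hl : PolyTime l)
    (hs : PolyTime s) (hstep : PolyTime fun p : α × β × σ => step p.1 p.2.1 p.2.2) (μ : σ → ℕ)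
    {d : α → ℕ} (hd : PolyBounded d) (hμ : ∀ s, esize s ≤ μ s) (hμs : PolyBounded fun x => μ (s x))
    (h : ∀ x, ∀ b ∈ l x, ∀ s, μ (step x b s) ≤ μ s + d x) :
    PolyTime fun x => (l x).foldl (fun s b => step x b s) (s x) := by
  refine foldl (step := fun p : α × β × σ => step p.1 p.2.1 p.2.2) hl hs hstep
    (hμs.add (hl.1.mul hd)) fun x k hk => (hμ _).trans ?_
  have key : ∀ (k : List β) (s : σ), (∀ b ∈ k, b ∈ l x) →
      μ (k.foldl (fun s b => step x b s) s) ≤ μ s + k.length * d x := by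
    intro k
    induction k with
    | nil => intro s _; simp
    | cons b k ih =>
      intro s hk
      have h₁ := ih (step x b s) fun c hc => hk c (List.mem_cons_of_mem _ hc)
      have h₂ := h x b (hk b List.mem_cons_self) s
      simp only [List.foldl_cons, List.length_cons]
      rw [Nat.add_mul]
      omega
  refine (key k (s x) fun b hb => hk.subset hb).trans ?_
  have := Nat.mul_le_mul_right (d x) (hk.length_le.trans (length_lt_esize (l x)).le)
  omega

theorem foldl_of_le {l : α → List β} {s : α → σ} {step : α → β → σ → σ} (hl : PolyTime l)
    (hs : PolyTime s) (hstep : PolyTime fun p : α × β × σ => step p.1 p.2.1 p.2.2)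
    {d : α → ℕ} (hd : PolyBounded d)
    (h : ∀ x, ∀ b ∈ l x, ∀ s, esize (step x b s) ≤ esize s + d x) :
    PolyTime fun x => (l x).foldl (fun s b => step x b s) (s x) :=
  foldl_of_measure hl hs hstep esize hd (fun _ => le_rfl) hs.1 h

theorem and {f g : α → Bool} (hf : PolyTime f) (hg : PolyTime g) : PolyTime fun x => f x && g x := by
  have := cond hf hg (const false)
  convert this using 2 with x
  cases f x <;> rfl

theorem or {f g : α → Bool} (hf : PolyTime f) (hg : PolyTime g) : PolyTime fun x => f x || g x := by
  have := cond hf (const true) hg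
  convert this using 2 with x
  cases f x <;> rfl

theorem not {f : α → Bool} (hf : PolyTime f) : PolyTime fun x => !f x := by
  have := cond hf (const false) (const true)
  convert this using 2 with x
  cases f x <;> rfl

theorem any {l : α → List β} {c : α → β → Bool} (hl : PolyTime l)
    (hc : PolyTime fun p : α × β => c p.1 p.2) : PolyTime fun x => (l x).any (c x) := by
  have := foldl_of_le (step := fun x b s => s || c x b) hl (const false)
    ((snd.comp snd).or (hc.comp (fst.pair (fst.comp snd)))) (.const 0) (by simp)
  convert this using 2 with x
  rw [List.foldl_or_eq_any, Bool.false_or]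

theorem reverse_append {f g : α → List β} (hf : PolyTime f) (hg : PolyTime g) :
    PolyTime fun x => (f x).reverse ++ g x := by
  have := foldl_of_le (step := fun _ b s => b :: s) hf hg ((fst.comp snd).cons (snd.comp snd))
    (hf.1.add (.const 1)) fun x b hb s => by
      have := esize_le_of_mem hb
      simp only [esize_cons]; omega
  convert this using 2 with x
  simp

theorem reverse {f : α → List β} (hf : PolyTime f) : PolyTime fun x => (f x).reverse := by
  simpa using hf.reverse_append (const ([] : List β))

end PolyTime

/-! ### Binary arithmetic in polynomial time -/

/-- Natural numbers are written in binary. -/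
instance : Enc ℕ := ⟨fun k => enc k.bits⟩

theorem esize_listBool (l : List Bool) : esize l = 2 * l.length + 1 := by
  induction l with
  | nil => rfl
  | cons x l ih => simp [ih]; omega

theorem esize_nat (k : ℕ) : esize k = 2 * k.size + 1 := by
  rw [← Nat.size_eq_bits_len]
  exact esize_listBool _

theorem Nat.size_bit_le (b : Bool) (k : ℕ) : (Nat.bit b k).size ≤ k.size + 1 := by
  by_cases h : Nat.bit b k = 0
  · simp [h]
  · rw [Nat.size_bit h]

theorem Nat.size_div2 (k : ℕ) : k.div2.size = k.size - 1 := by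
  rw [← Nat.size_eq_bits_len, ← Nat.size_eq_bits_len, Nat.div2_bits_eq_tail, List.length_tail]

theorem Nat.size_add_le (j k : ℕ) : (j + k).size ≤ max j.size k.size + 1 := by
  rw [Nat.size_le, pow_succ]
  have hj := (Nat.lt_size_self j).trans_le (Nat.pow_le_pow_right two_pos (le_max_left j.size k.size))
  have hk := (Nat.lt_size_self k).trans_le (Nat.pow_le_pow_right two_pos (le_max_right j.size k.size))
  omega

theorem Nat.size_mul_le (j k : ℕ) : (j * k).size ≤ j.size + k.size := by
  rw [Nat.size_le, pow_add]
  exact Nat.mul_lt_mul'' (Nat.lt_size_self j) (Nat.lt_size_self k)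

/-- One step of binary addition: remaining summands, carry, and the bits of the sum so far. -/
def addStep (s : ℕ × ℕ × Bool × List Bool) : ℕ × ℕ × Bool × List Bool :=
  (s.1.div2, s.2.1.div2,
    bif s.1.bodd then (s.2.1.bodd || s.2.2.1) else (s.2.1.bodd && s.2.2.1),
    ((s.1.bodd ^^ s.2.1.bodd) ^^ s.2.2.1) :: s.2.2.2)

/-- One step of binary comparison: remaining numbers, and whether the lower part of the first is at
most that of the second. -/
def leStep (s : ℕ × ℕ × Bool) : ℕ × ℕ × Bool :=
  (s.1.div2, s.2.1.div2, bif (s.1.bodd ^^ s.2.1.bodd) then s.2.1.bodd else s.2.2)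

theorem size_iterate_div2 (j k : ℕ) : (Nat.div2^[k] j).size = j.size - k := by
  induction k generalizing j with
  | zero => rfl
  | succ k ih => rw [Function.iterate_succ_apply, ih, Nat.size_div2]; omega

/-- Invariant of addition: appending the bits produced so far below the sum of remaining summands
and carry gives back the original sum. The newest output bit is at the head and is the most
significant, which is why a left fold rebuilds the number. -/
theorem foldl_addStep (l : List Bool) : ∀ s : ℕ × ℕ × Bool × List Bool,
    let u := l.foldl (fun s _ => addStep s) s
    u.1 = Nat.div2^[l.length] s.1 ∧ u.2.1 = Nat.div2^[l.length] s.2.1 ∧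
      u.2.2.2.foldl (fun k b => Nat.bit b k) (u.1 + u.2.1 + u.2.2.1.toNat) =
        s.2.2.2.foldl (fun k b => Nat.bit b k) (s.1 + s.2.1 + s.2.2.1.toNat) := by
  induction l with
  | nil => intro s; simp
  | cons _ l ih =>
    intro s
    obtain ⟨h₁, h₂, h₃⟩ := ih (addStep s)
    refine ⟨h₁, h₂, h₃.trans ?_⟩
    simp only [addStep, List.foldl_cons]
    congr 1
    obtain ⟨x, y, c, o⟩ := s
    have hx := Nat.bodd_add_div2 x
    have hy := Nat.bodd_add_div2 y
    dsimp only
    rw [Nat.bit_val]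
    generalize x.div2 = x' at *
    generalize y.div2 = y' at *
    revert hx hy
    cases x.bodd <;> cases y.bodd <;> cases c <;> simp <;> omega

/-- Low bits are read first, so a later difference overrides an earlier one. Invariant: compare the
remaining high parts and let the flag decide ties. -/
theorem foldl_leStep (l : List Bool) : ∀ s : ℕ × ℕ × Bool,
    let u := l.foldl (fun s _ => leStep s) s
    u.1 = Nat.div2^[l.length] s.1 ∧ u.2.1 = Nat.div2^[l.length] s.2.1 ∧
      ((u.1 < u.2.1 ∨ u.1 = u.2.1 ∧ u.2.2 = true) ↔
        (s.1 < s.2.1 ∨ s.1 = s.2.1 ∧ s.2.2 = true)) := by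
  induction l with
  | nil => intro s; simp
  | cons _ l ih =>
    intro s
    obtain ⟨h₁, h₂, h₃⟩ := ih (leStep s)
    refine ⟨h₁, h₂, h₃.trans ?_⟩
    simp only [leStep]
    obtain ⟨x, y, c⟩ := s
    have hx := Nat.bodd_add_div2 x
    have hy := Nat.bodd_add_div2 y
    dsimp only
    generalize x.div2 = x' at *
    generalize y.div2 = y' at *
    revert hx hy
    cases x.bodd <;> cases y.bodd <;> cases c <;> simp <;> omega

theorem add_eq_foldl (x y : ℕ) (l : List Bool) (hx : x.size ≤ l.length) (hy : y.size ≤ l.length) :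
    x + y = (l.foldl (fun s _ => addStep s) (x, y, false, [])).2.2.2.foldl
      (fun k b => Nat.bit b k)
        (l.foldl (fun s _ => addStep s) (x, y, false, [])).2.2.1.toNat := by
  obtain ⟨h₁, h₂, h₃⟩ := foldl_addStep l (x, y, false, [])
  have e₁ := size_iterate_div2 x l.length
  have e₂ := size_iterate_div2 y l.length
  rw [Nat.sub_eq_zero_of_le hx, Nat.size_eq_zero] at e₁
  rw [Nat.sub_eq_zero_of_le hy, Nat.size_eq_zero] at e₂
  rw [h₁, h₂, e₁, e₂] at h₃
  simpa using h₃.symm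

theorem le_iff_foldl (x y : ℕ) (l : List Bool) (hx : x.size ≤ l.length) (hy : y.size ≤ l.length) :
    decide (x ≤ y) = (l.foldl (fun s _ => leStep s) (x, y, true)).2.2 := by
  obtain ⟨h₁, h₂, h₃⟩ := foldl_leStep l (x, y, true)
  have e₁ := size_iterate_div2 x l.length
  have e₂ := size_iterate_div2 y l.length
  rw [Nat.sub_eq_zero_of_le hx, Nat.size_eq_zero] at e₁
  rw [Nat.sub_eq_zero_of_le hy, Nat.size_eq_zero] at e₂
  rw [h₁, h₂, e₁, e₂] at h₃
  rw [Bool.eq_iff_iff, decide_eq_true_eq, le_iff_lt_or_eq]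
  simpa using h₃.symm

/-- A partial product over `k` bits is at most `(2 ^ k - 1) * y`, stated without subtraction. This
bounds the intermediate numbers of multiplication. -/
theorem foldl_double_add (y : ℕ) (l : List Bool) :
    l.foldl (fun s b => Nat.bit false s + bif b then y else 0) 0 + y ≤ 2 ^ l.length * y := by
  induction l using List.reverseRecOn with
  | nil => simp
  | append_singleton l b ih =>
    simp only [List.foldl_append, List.foldl_cons, List.foldl_nil, List.length_append,
      List.length_singleton, pow_succ, Nat.bit_val, Bool.toNat_false] at ih ⊢
    cases b <;> simp only [cond_true, cond_false] <;> nlinarith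

/-- Horner's scheme along the bits of `x`, most significant first. -/
theorem mul_eq_foldl (x y : ℕ) :
    x * y = x.bits.reverse.foldl (fun s b => Nat.bit false s + bif b then y else 0) 0 := by
  rw [List.foldl_reverse]
  induction x using Nat.binaryRec' with
  | zero => simp
  | bit b k hk ih =>
    rw [Nat.bits_append_bit k b hk, List.foldr_cons, ← ih, Nat.bit_val, Nat.bit_val]
    cases b <;> simp <;> ring

namespace PolyTime

variable {α β γ δ σ : Type} [Enc α] [Enc β] [Enc γ] [Enc δ] [Enc σ]

theorem bits {f : α → ℕ} (hf : PolyTime f) : PolyTime fun x => (f x).bits :=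
  hf.of_enc_eq fun _ => rfl

theorem bodd {f : α → ℕ} (hf : PolyTime f) : PolyTime fun x => (f x).bodd := by
  have := listCases hf.bits (const false) (fst.comp fst)
  convert this using 2 with x
  rw [Nat.bodd_eq_bits_head]
  cases (f x).bits <;> rfl

theorem div2 {f : α → ℕ} (hf : PolyTime f) : PolyTime fun x => (f x).div2 := by
  have := listCases hf.bits (const []) (snd.comp fst)
  refine this.of_enc_eq fun x => ?_
  change _ = enc (f x).div2.bits
  rw [Nat.div2_bits_eq_tail]
  cases (f x).bits <;> rfl

theorem bit {b : α → Bool} {f : α → ℕ} (hb : PolyTime b) (hf : PolyTime f) :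
    PolyTime fun x => Nat.bit (b x) (f x) := by
  -- Zero has no bits, so a `false` bit must not be prepended to the empty list.
  have := listCases hf.bits (cond hb (const [true]) (const []))
    ((hb.comp snd).cons (hf.bits.comp snd))
  refine this.of_enc_eq fun x => ?_
  change _ = enc (Nat.bit (b x) (f x)).bits
  by_cases h : f x = 0
  · cases e : b x <;> simp [h]
  · rw [Nat.bits_append_bit _ _ fun h' => absurd h' h]
    rcases e : (f x).bits with _ | ⟨c, t⟩
    · have := Nat.size_eq_bits_len (f x)
      rw [e] at this
      exact absurd (Nat.size_eq_zero.1 this.symm) h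
    · simp [e]

theorem xor {f g : α → Bool} (hf : PolyTime f) (hg : PolyTime g) :
    PolyTime fun x => f x ^^ g x := by
  have := cond hf hg.not hg
  convert this using 2 with x
  cases f x <;> cases g x <;> rfl

theorem foldl_bit {l : α → List Bool} {f : α → ℕ} (hl : PolyTime l) (hf : PolyTime f) :
    PolyTime fun x => (l x).foldl (fun k b => Nat.bit b k) (f x) :=
  foldl_of_le (step := fun _ b k => Nat.bit b k) hl hf (bit (fst.comp snd) (snd.comp snd))
    (.const 2) fun x b _ s => by
      have := Nat.size_bit_le b s
      simp only [esize_nat]; omega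

theorem esize_div2_le (k : ℕ) : esize k.div2 ≤ esize k := by
  have := Nat.size_div2 k
  simp only [esize_nat]; omega

theorem add {f g : α → ℕ} (hf : PolyTime f) (hg : PolyTime g) : PolyTime fun x => f x + g x := by
  have hs : PolyTime fun p : α × Bool × ℕ × ℕ × Bool × List Bool => p.2.2 := snd.comp snd
  -- The list is only a clock: its length, the sum of the two bit lengths, suffices to exhaust both
  -- summands.
  have h := foldl_of_le (step := fun _ _ s => addStep s) (hf.bits.reverse_append hg.bits)
    (hf.pair (hg.pair (const (false, ([] : List Bool)))))
    ((div2 (fst.comp hs)).pair ((div2 (fst.comp (snd.comp hs))).pair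
      ((cond (bodd (fst.comp hs))
        (or (bodd (fst.comp (snd.comp hs))) (fst.comp (snd.comp (snd.comp hs))))
        (and (bodd (fst.comp (snd.comp hs))) (fst.comp (snd.comp (snd.comp hs))))).pair
      (cons (xor (xor (bodd (fst.comp hs)) (bodd (fst.comp (snd.comp hs))))
        (fst.comp (snd.comp (snd.comp hs)))) (snd.comp (snd.comp (snd.comp hs)))))))
    (.const 2) fun x b _ s => by
      have h₁ := esize_div2_le s.1
      have h₂ := esize_div2_le s.2.1
      simp only [addStep, esize_prod, esize_cons, esize_bool]
      omega
  have := foldl_bit (snd.comp (snd.comp (snd.comp h)))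
    (cond (fst.comp (snd.comp (snd.comp h))) (const 1) (const 0))
  convert this using 2 with x
  exact add_eq_foldl (f x) (g x) _ (by simp [Nat.size_eq_bits_len])
    (by simp [Nat.size_eq_bits_len])

theorem le {f g : α → ℕ} (hf : PolyTime f) (hg : PolyTime g) :
    PolyTime fun x => decide (f x ≤ g x) := by
  have hs : PolyTime fun p : α × Bool × ℕ × ℕ × Bool => p.2.2 := snd.comp snd
  have h := foldl_of_le (step := fun _ _ s => leStep s) (hf.bits.reverse_append hg.bits)
    (hf.pair (hg.pair (const true)))
    ((div2 (fst.comp hs)).pair ((div2 (fst.comp (snd.comp hs))).pair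
      (cond (xor (bodd (fst.comp hs)) (bodd (fst.comp (snd.comp hs))))
        (bodd (fst.comp (snd.comp hs))) (snd.comp (snd.comp hs)))))
    (.const 0) fun x b _ s => by
      have h₁ := esize_div2_le s.1
      have h₂ := esize_div2_le s.2.1
      simp only [leStep, esize_prod, esize_bool]
      omega
  have := snd.comp (snd.comp h)
  convert this using 2 with x
  exact le_iff_foldl (f x) (g x) _ (by simp [Nat.size_eq_bits_len])
    (by simp [Nat.size_eq_bits_len])

theorem mul {f g : α → ℕ} (hf : PolyTime f) (hg : PolyTime g) : PolyTime fun x => f x * g x := by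
  have h := foldl (step := fun p : α × Bool × ℕ => Nat.bit false p.2.2 + bif p.2.1 then g p.1 else 0)
    hf.bits.reverse (const 0) (add (bit (const false) (snd.comp snd))
      (cond (fst.comp snd) (hg.comp fst) (const 0)))
    (m := fun x => 2 * (esize (f x) + esize (g x)) + 1)
    (((PolyBounded.const 2).mul (hf.1.add hg.1)).add (.const 1)) fun x k hk => by
      have h₁ := foldl_double_add (g x) k
      have h₂ := Nat.size_le_size ((Nat.le_add_right _ _).trans h₁)
      have h₃ := h₂.trans (Nat.size_mul_le _ _)
      have h₄ := hk.length_le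
      rw [Nat.size_pow] at h₃
      rw [List.length_reverse, Nat.size_eq_bits_len] at h₄
      simp only [esize_nat]
      omega
  convert h using 2 with x
  exact mul_eq_foldl _ _

end PolyTime

/-! ### The decision algorithm -/

/-- Comparison of fractions, given by numerator and denominator. -/
def fracLe (p q : ℕ × ℕ) : Bool := decide (p.1 * q.2 ≤ q.1 * p.2)

/-- Fractions are not reduced: no gcd is needed, and lengths grow only additively along a sum. -/
def fracAdd (p q : ℕ × ℕ) : ℕ × ℕ := (p.1 * q.2 + q.1 * p.2, p.2 * q.2)

def fracDiv (p q : ℕ × ℕ) : ℕ × ℕ := (p.1 * q.2, p.2 * q.1)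

/-- Reward level and endowment of an agent. -/
abbrev Agent := (ℕ × ℕ) × (ℕ × ℕ)

namespace Agent

/-- The least total contribution at which the agent is willing to participate. -/
def demand (i : Agent) : ℕ × ℕ := fracDiv i.2 i.1

/-- The total endowment of the agents with demand at most `t` and endowment larger than `e`. -/
def sumAbove (t e : ℕ × ℕ) (l : List Agent) : ℕ × ℕ :=
  l.foldl (fun s i => bif fracLe i.demand t && !fracLe i.2 e then fracAdd s i.2 else s) (0, 1)

/-- Add the endowments of agents with demand at most `t` and endowment `e` to `s`, as long as the
sum is below the threshold `τ`. -/
def addTies (τ t e s : ℕ × ℕ) (l : List Agent) : ℕ × ℕ :=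
  l.foldl (fun s i => bif fracLe i.demand t && (fracLe i.2 e && fracLe e i.2) && !fracLe τ s
    then fracAdd s i.2 else s) s

/-- The total contribution of the greedy set for the demand bound of `i`, if `j` is its last
member. -/
def greedySum (τ : ℕ × ℕ) (l : List Agent) (i j : Agent) : ℕ × ℕ :=
  addTies τ i.demand j.2 (sumAbove i.demand j.2 l) l

/-- Whether some greedy set is a cooperative equilibrium. -/
def accepts (τ : ℕ × ℕ) (l : List Agent) : Bool :=
  -- For `τ = 0` the empty set is an equilibrium. Otherwise `i` supplies the demand bound and `j`
  -- the cutoff weight at which the greedy choice reaches the threshold.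
  fracLe τ (0, 1) || l.any fun i => l.any fun j =>
    !fracLe τ (sumAbove i.demand j.2 l) &&
      (fracLe τ (greedySum τ l i j) && fracLe i.demand (greedySum τ l i j))

end Agent

attribute [irreducible] fracLe fracAdd Agent.demand Agent.sumAbove Agent.addTies

/-- Pair up successive entries; the first component of the result is the list of the at most one
entry left over, the second consists of the pairs in reverse order. -/
def pairUp {α : Type} (l : List α) : List α × List (α × α) :=
  l.foldl (fun s x => List.casesOn s.1 ([x], s.2) fun y _ => ([], (y, x) :: s.2)) ([], [])

/-- Read a list of natural numbers from the reversed input. -/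
def parseFields (l : List (Bool × Bool)) : List ℕ :=
  -- In reverse order the terminating comma precedes its field and opens it with value 0; the bits
  -- then come most significant first.
  l.foldl (fun s x => bif x.1 then
    List.casesOn (motive := fun _ => List ℕ) s [] fun k t => Nat.bit x.2 k :: t else 0 :: s) []

/-- The first pairing yields the fractions in reverse, `m_n, e_n, …, m_1, e_1, τ`. The second
therefore forms agents with the reward level first, leaves `τ` over, and restores the order of the
agents. -/
def pairUpFields (w : List (Bool × Bool)) : List (ℕ × ℕ) × List Agent :=
  pairUp (pairUp (parseFields w)).2

/-- The decision algorithm. -/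
def decideInput (w : List (Bool × Bool)) : Bool :=
  List.casesOn (pairUpFields w).1 false fun τ _ => Agent.accepts τ (pairUpFields w).2

/-! ### Polynomial running time of the algorithm -/

namespace PolyTime

variable {α β : Type} [Enc α] [Enc β]

theorem fracLe {f g : α → ℕ × ℕ} (hf : PolyTime f) (hg : PolyTime g) :
    PolyTime fun x => fracLe (f x) (g x) :=
  by
  unfold _root_.fracLe
  exact le (mul (fst.comp hf) (snd.comp hg)) (mul (fst.comp hg) (snd.comp hf))

theorem fracAdd {f g : α → ℕ × ℕ} (hf : PolyTime f) (hg : PolyTime g) :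
    PolyTime fun x => fracAdd (f x) (g x) := by
  unfold _root_.fracAdd
  exact (add (mul (fst.comp hf) (snd.comp hg)) (mul (fst.comp hg) (snd.comp hf))).pair
    (mul (snd.comp hf) (snd.comp hg))

theorem demand {f : α → Agent} (hf : PolyTime f) : PolyTime fun x => (f x).demand := by
  unfold Agent.demand fracDiv
  exact (mul (fst.comp (snd.comp hf)) (snd.comp (fst.comp hf))).pair
    (mul (snd.comp (snd.comp hf)) (fst.comp (fst.comp hf)))

/-- An upper bound for the size of a fraction that sums respect. -/
def fracMeasure (p : ℕ × ℕ) : ℕ := 4 * max p.1.size p.2.size + 3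

theorem esize_le_fracMeasure (p : ℕ × ℕ) : esize p ≤ fracMeasure p := by
  simp only [esize_prod, esize_nat, fracMeasure]; omega

theorem fracMeasure_le_esize (p : ℕ × ℕ) : fracMeasure p ≤ 2 * esize p := by
  simp only [esize_prod, esize_nat, fracMeasure]; omega

/-- The total length of numerator and denominator could nearly double in one addition, since the new
numerator may be as long as the old denominator. The maximum of the two lengths grows only by an
amount depending on the summand. -/
theorem fracMeasure_fracAdd (p q : ℕ × ℕ) :
    fracMeasure (_root_.fracAdd p q) ≤ fracMeasure p + (4 + 4 * esize q) := by
  have h₁ := Nat.size_add_le (p.1 * q.2) (q.1 * p.2)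
  have h₂ := Nat.size_mul_le p.1 q.2
  have h₃ := Nat.size_mul_le q.1 p.2
  have h₄ := Nat.size_mul_le p.2 q.2
  simp only [esize_prod, esize_nat, fracMeasure, _root_.fracAdd]
  omega

/-- Conditional sums of fractions attached to the entries of a list. -/
theorem foldl_fracAdd {l : α → List β} {s : α → ℕ × ℕ} {c : α → β → ℕ × ℕ → Bool} {e : β → ℕ × ℕ}
    (hl : PolyTime l) (hs : PolyTime s)
    (hc : PolyTime fun p : α × β × (ℕ × ℕ) => c p.1 p.2.1 p.2.2) (he : PolyTime e)
    (hb : ∀ b, esize (e b) ≤ esize b) :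
    PolyTime fun x => (l x).foldl (fun s b => bif c x b s then _root_.fracAdd s (e b) else s)
      (s x) := by
  refine foldl_of_measure (step := fun x b s => bif c x b s then _root_.fracAdd s (e b) else s)
    hl hs (cond hc (fracAdd (snd.comp snd) (he.comp (fst.comp snd))) (snd.comp snd)) fracMeasure
    ((PolyBounded.const 4).add ((PolyBounded.const 4).mul hl.1)) esize_le_fracMeasure
    (((PolyBounded.const 2).mul hs.1).mono fun x => fracMeasure_le_esize _) fun x b hbl s => ?_
  have h₁ := esize_le_of_mem hbl
  have h₂ := hb b
  have h₃ := fracMeasure_fracAdd s (e b)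
  cases c x b s <;> simp only [cond_true, cond_false] <;> omega

theorem esize_endowment_le (i : Agent) : esize i.2 ≤ esize i := by
  have := esize_prod i
  omega

theorem sumAbove {t e : α → ℕ × ℕ} {l : α → List Agent} (ht : PolyTime t) (he : PolyTime e)
    (hl : PolyTime l) : PolyTime fun x => Agent.sumAbove (t x) (e x) (l x) := by
  unfold Agent.sumAbove
  have hi : PolyTime fun p : α × Agent × (ℕ × ℕ) => p.2.1 := fst.comp snd
  have ht' : PolyTime fun p : α × Agent × (ℕ × ℕ) => t p.1 := ht.comp fst
  have he' : PolyTime fun p : α × Agent × (ℕ × ℕ) => e p.1 := he.comp fst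
  have hi' : PolyTime fun p : α × Agent × (ℕ × ℕ) => p.2.1.2 := snd.comp hi
  have hc := and (fracLe (demand hi) ht') (not (fracLe hi' he'))
  have hs : PolyTime fun _ : α => ((0, 1) : ℕ × ℕ) := const (0, 1)
  have hend : PolyTime fun i : Agent => i.2 := snd
  have := foldl_fracAdd
    (c := fun x i _ => _root_.fracLe i.demand (t x) && !_root_.fracLe i.2 (e x))
    hl hs hc hend esize_endowment_le
  exact this

theorem addTies {τ t e s : α → ℕ × ℕ} {l : α → List Agent} (hτ : PolyTime τ) (ht : PolyTime t)
    (he : PolyTime e) (hs : PolyTime s) (hl : PolyTime l) :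
    PolyTime fun x => Agent.addTies (τ x) (t x) (e x) (s x) (l x) := by
  unfold Agent.addTies
  have hi : PolyTime fun p : α × Agent × (ℕ × ℕ) => p.2.1 := fst.comp snd
  have ht' : PolyTime fun p : α × Agent × (ℕ × ℕ) => t p.1 := ht.comp fst
  have he' : PolyTime fun p : α × Agent × (ℕ × ℕ) => e p.1 := he.comp fst
  have hτ' : PolyTime fun p : α × Agent × (ℕ × ℕ) => τ p.1 := hτ.comp fst
  have hi' : PolyTime fun p : α × Agent × (ℕ × ℕ) => p.2.1.2 := snd.comp hi
  have hs' : PolyTime fun p : α × Agent × (ℕ × ℕ) => p.2.2 := snd.comp snd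
  have hc := and (and (fracLe (demand hi) ht') (and (fracLe hi' he') (fracLe he' hi')))
    (not (fracLe hτ' hs'))
  have hend : PolyTime fun i : Agent => i.2 := snd
  have := foldl_fracAdd (c := fun x i s => _root_.fracLe i.demand (t x) &&
      (_root_.fracLe i.2 (e x) && _root_.fracLe (e x) i.2) && !_root_.fracLe (τ x) s)
    hl hs hc hend esize_endowment_le
  exact this

theorem accepts {τ : α → ℕ × ℕ} {l : α → List Agent} (hτ : PolyTime τ) (hl : PolyTime l) :
    PolyTime fun x => Agent.accepts (τ x) (l x) := by
  have hi : PolyTime fun p : (α × Agent) × Agent => p.1.2.demand := demand (snd.comp fst)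
  have hj : PolyTime fun p : (α × Agent) × Agent => p.2.2 := snd.comp snd
  have hl' : PolyTime fun p : (α × Agent) × Agent => l p.1.1 := hl.comp (fst.comp fst)
  have hτ' : PolyTime fun p : (α × Agent) × Agent => τ p.1.1 := hτ.comp (fst.comp fst)
  have hX := sumAbove hi hj hl'
  have hY := addTies hτ' hi hj hX hl'
  have h := and (not (fracLe hτ' hX)) (and (fracLe hτ' hY) (fracLe hi hY))
  have h₂ := any (c := fun (y : α × Agent) (j : Agent) =>
    !_root_.fracLe (τ y.1) (Agent.sumAbove y.2.demand j.2 (l y.1)) &&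
      (_root_.fracLe (τ y.1) (Agent.greedySum (τ y.1) (l y.1) y.2 j) &&
        _root_.fracLe y.2.demand (Agent.greedySum (τ y.1) (l y.1) y.2 j))) (hl.comp fst) h
  have h₁ := any (c := fun (x : α) (i : Agent) => (l x).any fun j =>
    !_root_.fracLe (τ x) (Agent.sumAbove i.demand j.2 (l x)) &&
      (_root_.fracLe (τ x) (Agent.greedySum (τ x) (l x) i j) &&
        _root_.fracLe i.demand (Agent.greedySum (τ x) (l x) i j))) hl h₂
  exact or (fracLe hτ (const (0, 1))) h₁

theorem pairUp {l : α → List β} (hl : PolyTime l) : PolyTime fun x => pairUp (l x) := by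
  have h := listCases (α := α × β × (List β × List (β × β))) (fst.comp (snd.comp snd))
    ((cons (fst.comp snd) (const [])).pair (snd.comp (snd.comp snd)))
    ((const []).pair (cons ((fst.comp fst).pair (fst.comp (snd.comp snd)))
      (snd.comp (snd.comp (snd.comp snd)))))
  refine foldl_of_le (step := fun _ x s =>
    List.casesOn (motive := fun _ => List β × List (β × β)) s.1 ([x], s.2)
      fun y _ => ([], (y, x) :: s.2)) hl (const ([], [])) h (hl.1.add (.const 3)) ?_
  intro x b hb s
  have := esize_le_of_mem hb
  obtain ⟨u, o⟩ := s
  rcases u with _ | ⟨y, u⟩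
  · simp only [esize_prod, esize_cons, esize_nil]; omega
  · simp only [esize_prod, esize_cons, esize_nil]; omega

theorem parseFields : PolyTime parseFields := by
  have h := cond (α := List (Bool × Bool) × (Bool × Bool) × List ℕ) (fst.comp (fst.comp snd))
    (listCases (snd.comp snd) (const []) (cons (bit (snd.comp (fst.comp (snd.comp snd)))
      (fst.comp fst)) (snd.comp fst))) (cons (const 0) (snd.comp snd))
  refine foldl_of_le (step := fun (_ : List (Bool × Bool)) (x : Bool × Bool) s => bif x.1 then
    List.casesOn (motive := fun _ => List ℕ) s [] fun k t => Nat.bit x.2 k :: t else 0 :: s)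
    (l := fun w : List (Bool × Bool) => w) id (const []) h (.const 2) ?_
  intro x b _ s
  cases b.1
  · simp [esize_nat]; omega
  · rcases s with _ | ⟨k, t⟩
    · simp
    · have := Nat.size_bit_le b.2 k
      simp only [cond_true, esize_cons, esize_nat]
      omega

theorem decideInput : PolyTime decideInput := by
  have h : PolyTime pairUpFields := pairUp (snd.comp (pairUp parseFields))
  exact listCases (fst.comp h) (const false) (accepts (fst.comp fst) (snd.comp (h.comp snd)))

end PolyTime

theorem inP_decideInput : InP (decidedLanguage decideInput) := InP.of_polyTime .decideInput

/-! ### Decoding of instances -/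

theorem foldr_bit_encodeNat (k : ℕ) :
    (encodeNat k).foldr (fun b k => Nat.bit b k) 0 = k := by
  have h : ∀ p : PosNum, (encodePosNum p).foldr (fun b k => Nat.bit b k) 0 = (p : ℕ) := by
    intro p
    induction p with
    | one => rfl
    | bit0 p ih =>
      rw [encodePosNum, List.foldr_cons, ih, Nat.bit_val, PosNum.cast_bit0, Bool.toNat_false]
      omega
    | bit1 p ih =>
      rw [encodePosNum, List.foldr_cons, ih, Nat.bit_val, PosNum.cast_bit1, Bool.toNat_true]
      omega
  have h' : ∀ x : Num, (encodeNum x).foldr (fun b k => Nat.bit b k) 0 = (x : ℕ) := by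
    intro x
    cases x with
    | zero => rfl
    | pos p => exact h p
  rw [encodeNat, h', Num.to_of_nat]

theorem parseFields_encode (l : List ℕ) :
    parseFields ((l.flatMap RationalInstance.encodeNatField).map symbolCode).reverse = l := by
  induction l with
  | nil => rfl
  | cons k l ih =>
    simp only [parseFields, List.foldl_reverse] at ih ⊢
    simp only [List.flatMap_cons, List.map_append, List.foldr_append, ih,
      RationalInstance.encodeNatField, List.map_cons, List.map_nil, List.foldr_cons, List.foldr_nil]
    conv_rhs => rw [← foldr_bit_encodeNat k]
    induction encodeNat k with
    | nil => rfl
    | cons b t ih => simp only [List.map_cons, List.foldr_cons, ih]; rfl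

theorem foldl_pairUp {α β : Type} (f g : β → α) (l : List β) (o : List (α × α)) :
    (l.flatMap fun b => [f b, g b]).foldl
      (fun s x => List.casesOn (motive := fun _ => List α × List (α × α)) s.1 ([x], s.2)
        fun y _ => ([], (y, x) :: s.2)) ([], o) = ([], (l.map fun b => (f b, g b)).reverse ++ o) := by
  induction l generalizing o with
  | nil => rfl
  | cons b l ih => simpa using ih _

theorem pairUp_flatMap {α β : Type} (f g : β → α) (l : List β) :
    pairUp (l.flatMap fun b => [f b, g b]) = ([], (l.map fun b => (f b, g b)).reverse) := by
  rw [pairUp, foldl_pairUp f g l [], List.append_nil]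

theorem pairUp_flatMap_append {α β : Type} (f g : β → α) (l : List β) (x : α) :
    pairUp ((l.flatMap fun b => [f b, g b]) ++ [x]) =
      ([x], (l.map fun b => (f b, g b)).reverse) := by
  rw [pairUp, List.foldl_append, foldl_pairUp f g l []]
  simp

namespace RationalInstance

/-- Numerator and denominator of a nonnegative rational number. -/
def frac (q : ℚ) : ℕ × ℕ := (q.num.toNat, q.den)

/-- The agents of an instance, as seen by the decision algorithm. -/
def agents (I : RationalInstance) : List Agent :=
  (List.finRange I.n).map fun i => (frac (I.m i), frac (I.e i))

theorem pairUpFields_encode (I : RationalInstance) :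
    pairUpFields (I.encode.map symbolCode).reverse = ([frac I.τ], I.agents) := by
  rw [pairUpFields, encode, parseFields_encode]
  have h : I.data = (I.τ :: (List.finRange I.n).flatMap fun i => [I.e i, I.m i]).flatMap
      fun q => [q.num.toNat, q.den] := by
    simp [data, ratData, List.flatMap_assoc]
  have h' : ((I.τ :: (List.finRange I.n).flatMap fun i => [I.e i, I.m i]).map
      fun q => (q.num.toNat, q.den)).reverse =
      (((List.finRange I.n).reverse.flatMap fun i => [frac (I.m i), frac (I.e i)]) ++
        [frac I.τ]) := by
    simp [frac, List.map_flatMap, List.reverse_flatMap, Function.comp_def]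
  rw [h, pairUp_flatMap, h', pairUp_flatMap_append]
  simp [agents]

theorem encode_mem_decidedLanguage (I : RationalInstance) :
    I.encode ∈ decidedLanguage decideInput ↔ Agent.accepts (frac I.τ) I.agents = true := by
  rw [mem_decidedLanguage, decideInput, pairUpFields_encode]

end RationalInstance

/-! ### Structure of cooperative equilibria -/

namespace PivotalGame

variable {n : ℕ} {G : PivotalGame n} {S P : Finset (Fin n)}

theorem contribution_erase {i : Fin n} (hi : i ∈ S) :
    G.contribution (S.erase i) = G.contribution S - G.e i := by
  rw [contribution, contribution, ← Finset.add_sum_erase S G.e hi]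
  ring

/-- If a member leaves, the project fails, so it compares `e i` with `m i * e(S)`. An outsider who
joins gains `m i * e i`, which is at most the `e i` given up. -/
theorem isCooperativeNash_of_pivotal (hS : G.Succeeds S)
    (h : ∀ i ∈ S, G.contribution S - G.e i < G.τ ∧ G.e i ≤ G.m i * G.contribution S) :
    G.IsCooperativeNash S := by
  refine ⟨⟨fun i hi => ?_, fun i hi => ?_⟩, hS⟩
  · obtain ⟨h₁, h₂⟩ := h i hi
    rw [← contribution_erase hi] at h₁
    have h₃ : ¬ G.Succeeds (S.erase i) := not_le.2 h₁
    simpa [utility, hi, hS, h₃] using h₂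
  · have hc : G.contribution (insert i S) = G.e i + G.contribution S := Finset.sum_insert hi
    have hS' : G.Succeeds (insert i S) :=
      le_trans (show G.τ ≤ G.contribution S from hS) (by rw [hc]; linarith [G.e_nonneg i])
    have := mul_le_of_le_one_left (G.e_nonneg i) (G.m_lt_one i).le
    simp only [utility, hi, hS, hS', hc, Finset.mem_insert_self, not_true_eq_false,
      not_false_eq_true, if_true, if_false]
    linarith

/-- If the project survived without `i`, leaving would gain `e i - m i * e i > 0`. Members with
endowment zero are indifferent, hence the positivity hypothesis. -/
theorem IsCooperativeNash.pivotal (h : G.IsCooperativeNash S) {i : Fin n} (hi : i ∈ S)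
    (hpos : 0 < G.e i) :
    G.contribution S - G.e i < G.τ ∧ G.e i ≤ G.m i * G.contribution S := by
  have h₁ := h.1.1 i hi
  have h₂ := contribution_erase (G := G) hi
  by_cases h₃ : G.Succeeds (S.erase i)
  · exfalso
    simp only [utility, hi, h.2, h₃, h₂, Finset.notMem_erase, not_true_eq_false,
      not_false_eq_true, if_true, if_false] at h₁
    have := mul_lt_of_lt_one_left hpos (G.m_lt_one i)
    linarith
  · refine ⟨by rw [← h₂]; exact not_le.1 h₃, ?_⟩
    simpa [utility, hi, h.2, h₃] using h₁

/-- A successful set whose lightest member is pivotal, and whose members all have demand at most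
the total contribution. -/
theorem isCooperativeNash_of_demand_le {w t : ℝ} (hS : G.Succeeds S)
    (hw : ∀ i ∈ S, w ≤ G.e i) (hlt : G.contribution S - w < G.τ)
    (ht : ∀ i ∈ S, G.e i / G.m i ≤ t) (htS : t ≤ G.contribution S) : G.IsCooperativeNash S :=
  isCooperativeNash_of_pivotal hS fun i hi => ⟨by linarith [hw i hi], by
    rw [mul_comm]
    exact (div_le_iff₀ (G.m_pos i)).1 ((ht i hi).trans htS)⟩

/-- In a balanced game a minimal set that contains all agents of `A` heavier than `w` and only
agents of weight at least `w` contributes at least as much as any minimal subset of `A`. -/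
theorem IsBalanced.contribution_le (hG : G.IsBalanced) (hS : G.IsMinimal S) (hP : G.IsMinimal P)
    {w : ℝ} (hw : ∀ i ∈ P, w ≤ G.e i) (hS' : ∀ i ∈ S, i ∉ P → G.e i ≤ w) :
    G.contribution S ≤ G.contribution P := by
  -- Here balancedness enters: the two differences have equally many elements, those of `S \ P`
  -- weighing at most `w` and those of `P \ S` at least `w`.
  have hc : (S \ P).card = (P \ S).card :=
    Finset.card_sdiff_comm (hG S P hS hP)
  have h₁ : ∑ i ∈ S \ P, G.e i ≤ (S \ P).card • w :=
    Finset.sum_le_card_nsmul _ _ _ fun i hi => by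
      rw [Finset.mem_sdiff] at hi
      exact hS' i hi.1 hi.2
  have h₂ : (P \ S).card • w ≤ ∑ i ∈ P \ S, G.e i :=
    Finset.card_nsmul_le_sum _ _ _ fun i hi => hw i (Finset.mem_sdiff.1 hi).1
  have h₃ := Finset.sum_inter_add_sum_sdiff S P G.e
  have h₄ := Finset.sum_inter_add_sum_sdiff P S G.e
  rw [Finset.inter_comm] at h₄
  rw [hc] at h₁
  rw [contribution, contribution]
  linarith

/-- If the agents in `A` together succeed, then some weight `w` is such that the agents heavier than
`w` fail and those of weight at least `w` succeed. -/
theorem exists_critical (hτ : 0 < G.τ) {A : Finset (Fin n)} (hA : G.Succeeds A) :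
    ∃ j ∈ A, G.contribution {i ∈ A | G.e j < G.e i} < G.τ ∧
      G.τ ≤ G.contribution {i ∈ A | G.e j ≤ G.e i} := by
  have hne : {j ∈ A | G.τ ≤ G.contribution {i ∈ A | G.e j ≤ G.e i}}.Nonempty := by
    have : A.Nonempty := by
      rw [Finset.nonempty_iff_ne_empty]
      rintro rfl
      have : G.τ ≤ 0 := hA
      linarith
    obtain ⟨j, hj, hmin⟩ := A.exists_min_image G.e this
    refine ⟨j, Finset.mem_filter.2 ⟨hj, ?_⟩⟩
    rwa [Finset.filter_true_of_mem hmin]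
  -- Take the heaviest `j` whose upper level set succeeds. If the strictly heavier agents succeeded,
  -- the lightest of them would be a heavier choice.
  obtain ⟨j, hj, hmax⟩ := Finset.exists_max_image _ G.e hne
  rw [Finset.mem_filter] at hj
  refine ⟨j, hj.1, ?_, hj.2⟩
  by_contra! hge
  have hne' : {i ∈ A | G.e j < G.e i}.Nonempty := by
    rw [Finset.nonempty_iff_ne_empty]
    intro h
    rw [h] at hge
    have : G.τ ≤ 0 := hge
    linarith
  obtain ⟨k, hk, hmin⟩ := Finset.exists_min_image _ G.e hne'
  rw [Finset.mem_filter] at hk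
  have := hmax k (Finset.mem_filter.2 ⟨hk.1, hge.trans
    (Finset.sum_le_sum_of_subset_of_nonneg (fun i hi => Finset.mem_filter.2
      ⟨(Finset.mem_filter.1 hi).1, hmin i hi⟩) fun i _ _ => G.e_nonneg i)⟩)
  linarith [hk.2]

/-- The positive members of a cooperative equilibrium form a minimal set. -/
theorem IsCooperativeNash.isMinimal (h : G.IsCooperativeNash S) :
    G.IsMinimal {i ∈ S | 0 < G.e i} ∧ G.contribution {i ∈ S | 0 < G.e i} = G.contribution S := by
  have hc : G.contribution {i ∈ S | 0 < G.e i} = G.contribution S := by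
    refine Finset.sum_filter_of_ne fun i _ hi => lt_of_le_of_ne (G.e_nonneg i) hi.symm
  refine ⟨⟨by rw [Succeeds, hc]; exact h.2, fun j hj => ?_⟩, hc⟩
  rw [contribution_erase hj, hc]
  rw [Finset.mem_filter] at hj
  exact (h.pivotal hj.1 hj.2).1

end PivotalGame

/-! ### Fractions -/

/-- The value of a fraction. -/
noncomputable def fracVal (p : ℕ × ℕ) : ℝ := p.1 / p.2

theorem fracLe_iff {p q : ℕ × ℕ} (hp : 0 < p.2) (hq : 0 < q.2) :
    fracLe p q = true ↔ fracVal p ≤ fracVal q := by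
  unfold fracLe
  rw [decide_eq_true_eq, fracVal, fracVal,
    div_le_div_iff₀ (by exact_mod_cast hp) (by exact_mod_cast hq)]
  norm_cast

theorem fracLe_eq_false_iff {p q : ℕ × ℕ} (hp : 0 < p.2) (hq : 0 < q.2) :
    fracLe p q = false ↔ fracVal q < fracVal p := by
  rw [← not_le, ← fracLe_iff hp hq, Bool.not_eq_true]

theorem fracAdd_den_pos {p q : ℕ × ℕ} (hp : 0 < p.2) (hq : 0 < q.2) : 0 < (fracAdd p q).2 := by
  unfold fracAdd
  exact Nat.mul_pos hp hq

theorem fracVal_fracAdd {p q : ℕ × ℕ} (hp : 0 < p.2) (hq : 0 < q.2) :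
    fracVal (fracAdd p q) = fracVal p + fracVal q := by
  unfold fracAdd
  have hp' : (p.2 : ℝ) ≠ 0 := by exact_mod_cast hp.ne'
  have hq' : (q.2 : ℝ) ≠ 0 := by exact_mod_cast hq.ne'
  simp only [fracVal, Nat.cast_add, Nat.cast_mul]
  field_simp

/-! ### Correctness of the algorithm on encoded instances -/

namespace RationalInstance

theorem frac_den_pos (q : ℚ) : 0 < (frac q).2 := q.den_pos

theorem fracVal_frac {q : ℚ} (hq : 0 ≤ q) : fracVal (frac q) = q := by
  have h : ((q.num.toNat : ℕ) : ℝ) = (q.num : ℝ) := by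
    exact_mod_cast Int.toNat_of_nonneg (Rat.num_nonneg.2 hq)
  rw [fracVal, frac, h]
  exact (Rat.cast_def q).symm

/-- An agent of an instance, as seen by the decision algorithm. -/
def agent (I : RationalInstance) (i : Fin I.n) : Agent := (frac (I.m i), frac (I.e i))

variable (I : RationalInstance)

theorem endowment_den_pos (i : Fin I.n) : 0 < (I.agent i).2.2 := frac_den_pos _

theorem fracVal_endowment (i : Fin I.n) : fracVal (I.agent i).2 = I.toGame.e i :=
  fracVal_frac (I.e_nonneg i)

theorem demand_den_pos (i : Fin I.n) : 0 < (I.agent i).demand.2 := by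
  unfold Agent.demand fracDiv
  have := Rat.num_pos.2 (I.m_pos i)
  exact Nat.mul_pos (I.e i).den_pos (show 0 < (I.m i).num.toNat by omega)

theorem fracVal_demand (i : Fin I.n) :
    fracVal (I.agent i).demand = I.toGame.e i / I.toGame.m i := by
  have he : I.toGame.e i = fracVal (I.agent i).2 := (I.fracVal_endowment i).symm
  have hm : I.toGame.m i = fracVal (I.agent i).1 := (fracVal_frac (I.m_pos i).le).symm
  unfold Agent.demand fracDiv
  rw [he, hm]
  simp only [fracVal, Nat.cast_mul]
  rw [div_div_div_eq]

theorem fracLe_demand {i j : Fin I.n} : fracLe (I.agent i).demand (I.agent j).demand = true ↔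
    I.toGame.e i / I.toGame.m i ≤ I.toGame.e j / I.toGame.m j := by
  rw [fracLe_iff (I.demand_den_pos i) (I.demand_den_pos j), fracVal_demand, fracVal_demand]

theorem fracLe_endowment {i j : Fin I.n} : fracLe (I.agent i).2 (I.agent j).2 = true ↔
    I.toGame.e i ≤ I.toGame.e j := by
  rw [fracLe_iff (I.endowment_den_pos i) (I.endowment_den_pos j), fracVal_endowment,
    fracVal_endowment]

theorem foldl_fracAdd_spec (c : Fin I.n → Bool) (L : List (Fin I.n)) (s : ℕ × ℕ) (hs : 0 < s.2) :
    0 < (L.foldl (fun s i => bif c i then fracAdd s (I.agent i).2 else s) s).2 ∧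
      fracVal (L.foldl (fun s i => bif c i then fracAdd s (I.agent i).2 else s) s) =
        fracVal s + (L.map fun i => if c i = true then I.toGame.e i else 0).sum := by
  induction L generalizing s with
  | nil => simpa using hs
  | cons i L ih =>
    cases h : c i
    · simpa [h] using ih s hs
    · have := ih _ (fracAdd_den_pos hs (I.endowment_den_pos i))
      rw [fracVal_fracAdd hs (I.endowment_den_pos i), fracVal_endowment] at this
      simpa [h, add_assoc] using this

theorem sumAbove_spec (i j : Fin I.n) :
    0 < (Agent.sumAbove (I.agent i).demand (I.agent j).2 I.agents).2 ∧
      fracVal (Agent.sumAbove (I.agent i).demand (I.agent j).2 I.agents) =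
        I.toGame.contribution {k | I.toGame.e k / I.toGame.m k ≤ I.toGame.e i / I.toGame.m i ∧
          I.toGame.e j < I.toGame.e k} := by
  have h := I.foldl_fracAdd_spec (fun k => fracLe (I.agent k).demand (I.agent i).demand &&
    !fracLe (I.agent k).2 (I.agent j).2) (List.finRange I.n) (0, 1) Nat.one_pos
  unfold Agent.sumAbove agents
  rw [List.foldl_map]
  refine ⟨h.1, h.2.trans ?_⟩
  rw [← Fin.sum_univ_def, PivotalGame.contribution, Finset.sum_filter]
  simp only [fracVal, Nat.cast_zero, zero_div, zero_add]
  refine Finset.sum_congr rfl fun k _ => if_congr ?_ rfl rfl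
  rw [Bool.and_eq_true, Bool.not_eq_true', ← Bool.not_eq_true, fracLe_demand, fracLe_endowment,
    not_le]

/-- `T` is the set of tied agents actually added; all weigh `w`, so it is irrelevant which of them
are taken. The clause giving `T = ∅` once the threshold is reached serves the induction. The last
two clauses say that the overshoot is less than `w` and that falling short means every tie was used.
-/
theorem foldl_addTies_spec {τ : ℕ × ℕ} (hτ : 0 < τ.2) {w : ℝ} (hw : 0 ≤ w) (c : Fin I.n → Bool)
    (hc : ∀ i, c i = true → I.toGame.e i = w) (L : List (Fin I.n)) (hL : L.Nodup) (s : ℕ × ℕ)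
    (hs : 0 < s.2) : ∃ T : Finset (Fin I.n),
    let u := L.foldl (fun s i => bif c i && !fracLe τ s then fracAdd s (I.agent i).2 else s) s
    0 < u.2 ∧ fracVal u = fracVal s + I.toGame.contribution T ∧
      (∀ i ∈ T, i ∈ L ∧ c i = true) ∧ (fracVal τ ≤ fracVal s → T = ∅) ∧
      (fracVal s < fracVal τ → fracVal u - w < fracVal τ) ∧
      (fracVal u < fracVal τ → ∀ i ∈ L, c i = true → i ∈ T) := by
  induction L generalizing s with
  | nil => exact ⟨∅, by simpa [PivotalGame.contribution, hs] using fun h => by linarith⟩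
  | cons i L ih =>
    rw [List.nodup_cons] at hL
    by_cases h : (c i && !fracLe τ s) = true
    · have hi := h
      rw [Bool.and_eq_true, Bool.not_eq_true', fracLe_eq_false_iff hτ hs] at hi
      obtain ⟨T, h₁, h₂, h₃, h₄, h₅, h₆⟩ := ih hL.2 _ (fracAdd_den_pos hs (I.endowment_den_pos i))
      rw [fracVal_fracAdd hs (I.endowment_den_pos i), fracVal_endowment, hc i hi.1] at h₂ h₄ h₅
      have hiT : i ∉ T := fun hT => hL.1 (h₃ i hT).1
      refine ⟨insert i T, ?_⟩
      simp only [List.foldl_cons, h, cond_true]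
      refine ⟨h₁, ?_, ?_, fun h' => absurd hi.2 (not_lt.2 h'), fun _ => ?_, fun h' k hk hck => ?_⟩
      · rw [h₂, PivotalGame.contribution, PivotalGame.contribution, Finset.sum_insert hiT,
          hc i hi.1]
        ring
      · intro k hk
        rcases Finset.mem_insert.1 hk with rfl | hk
        · exact ⟨List.mem_cons_self, hi.1⟩
        · exact ⟨List.mem_cons_of_mem _ (h₃ k hk).1, (h₃ k hk).2⟩
      -- If this addition reaches the threshold, nothing further is added, and subtracting `w`
      -- returns to the value before it.
      · rcases lt_or_ge (fracVal s + w) (fracVal τ) with hlt | hge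
        · exact h₅ hlt
        · rw [h₂, h₄ hge, PivotalGame.contribution, Finset.sum_empty]
          linarith [hi.2]
      · rcases List.mem_cons.1 hk with rfl | hk
        · exact Finset.mem_insert_self _ _
        · exact Finset.mem_insert_of_mem (h₆ h' k hk hck)
    · obtain ⟨T, h₁, h₂, h₃, h₄, h₅, h₆⟩ := ih hL.2 s hs
      rw [Bool.not_eq_true] at h
      refine ⟨T, ?_⟩
      simp only [List.foldl_cons, h, cond_false]
      refine ⟨h₁, h₂, fun k hk => ⟨List.mem_cons_of_mem _ (h₃ k hk).1, (h₃ k hk).2⟩, h₄, h₅,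
        fun h' k hk hck => ?_⟩
      rcases List.mem_cons.1 hk with rfl | hk
      · rw [hck, Bool.true_and, Bool.not_eq_false', fracLe_iff hτ hs] at h
        rw [h₂, h₄ h, PivotalGame.contribution, Finset.sum_empty] at h'
        linarith
      · exact h₆ h' k hk hck

/-- The greedy sum is the contribution of a greedy set. -/
theorem greedySum_spec (i j : Fin I.n)
    (h : I.toGame.contribution {k | I.toGame.e k / I.toGame.m k ≤ I.toGame.e i / I.toGame.m i ∧
          I.toGame.e j < I.toGame.e k} < I.toGame.τ) :
    0 < (Agent.greedySum (frac I.τ) I.agents (I.agent i) (I.agent j)).2 ∧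
    ∃ P : Finset (Fin I.n),
      fracVal (Agent.greedySum (frac I.τ) I.agents (I.agent i) (I.agent j)) =
        I.toGame.contribution P ∧
      (∀ k ∈ P, I.toGame.e k / I.toGame.m k ≤ I.toGame.e i / I.toGame.m i ∧
        I.toGame.e j ≤ I.toGame.e k) ∧
      I.toGame.contribution P - I.toGame.e j < I.toGame.τ ∧
      (∀ k, I.toGame.e k / I.toGame.m k ≤ I.toGame.e i / I.toGame.m i →
        I.toGame.e j < I.toGame.e k → k ∈ P) ∧
      (I.toGame.contribution P < I.toGame.τ →
        ∀ k, I.toGame.e k / I.toGame.m k ≤ I.toGame.e i / I.toGame.m i →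
          I.toGame.e j ≤ I.toGame.e k → k ∈ P) := by
  obtain ⟨hd, hX⟩ := I.sumAbove_spec i j
  have hτ : fracVal (frac I.τ) = I.toGame.τ := fracVal_frac I.τ_nonneg
  have hc : ∀ k, (fracLe (I.agent k).demand (I.agent i).demand &&
      (fracLe (I.agent k).2 (I.agent j).2 && fracLe (I.agent j).2 (I.agent k).2)) = true ↔
      I.toGame.e k / I.toGame.m k ≤ I.toGame.e i / I.toGame.m i ∧
        I.toGame.e k = I.toGame.e j := by
    intro k
    rw [Bool.and_eq_true, Bool.and_eq_true, fracLe_demand, fracLe_endowment, fracLe_endowment,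
      le_antisymm_iff]
  obtain ⟨T, h₁, h₂, h₃, -, h₅, h₆⟩ := I.foldl_addTies_spec (frac_den_pos I.τ) (I.toGame.e_nonneg j)
    (fun k => fracLe (I.agent k).demand (I.agent i).demand &&
      (fracLe (I.agent k).2 (I.agent j).2 && fracLe (I.agent j).2 (I.agent k).2))
    (fun k hk => ((hc k).1 hk).2) (List.finRange I.n) (List.nodup_finRange _) _ hd
  have e : Agent.greedySum (frac I.τ) I.agents (I.agent i) (I.agent j) =
      (List.finRange I.n).foldl (fun s k => bif (fracLe (I.agent k).demand (I.agent i).demand &&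
        (fracLe (I.agent k).2 (I.agent j).2 && fracLe (I.agent j).2 (I.agent k).2)) &&
          !fracLe (frac I.τ) s then fracAdd s (I.agent k).2 else s)
        (Agent.sumAbove (I.agent i).demand (I.agent j).2 I.agents) := by
    unfold Agent.greedySum Agent.addTies
    conv_lhs => rw [agents, List.foldl_map]
    rfl
  rw [← e] at h₁ h₂ h₅ h₆
  rw [hX, hτ] at h₅
  rw [hτ] at h₆
  rw [hX] at h₂
  simp only [hc] at h₃ h₆
  set F : Finset (Fin I.n) := {k | I.toGame.e k / I.toGame.m k ≤ I.toGame.e i / I.toGame.m i ∧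
    I.toGame.e j < I.toGame.e k} with hF
  have hdisj : Disjoint F T := Finset.disjoint_left.2 fun k hk hk' => by
    rw [hF, Finset.mem_filter] at hk
    exact hk.2.2.ne' (h₃ k hk').2.2
  have hsum : fracVal (Agent.greedySum (frac I.τ) I.agents (I.agent i) (I.agent j)) =
      I.toGame.contribution (F ∪ T) := by
    rw [h₂]
    exact (Finset.sum_union hdisj).symm
  rw [hsum] at h₅ h₆
  refine ⟨h₁, F ∪ T, hsum, fun k hk => ?_, h₅ h, fun k hk hjk => ?_, fun hlt k hk hjk => ?_⟩
  · rcases Finset.mem_union.1 hk with hk | hk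
    · rw [hF, Finset.mem_filter] at hk
      exact ⟨hk.2.1, hk.2.2.le⟩
    · exact ⟨(h₃ k hk).2.1, (h₃ k hk).2.2.ge⟩
  · exact Finset.mem_union_left _ (Finset.mem_filter.2 ⟨Finset.mem_univ _, hk, hjk⟩)
  · rcases hjk.lt_or_eq with hjk | hjk
    · exact Finset.mem_union_left _ (Finset.mem_filter.2 ⟨Finset.mem_univ _, hk, hjk⟩)
    · exact Finset.mem_union_right _ (h₆ hlt k (List.mem_finRange k) ⟨hk, hjk.symm⟩)

theorem accepts_iff : Agent.accepts (frac I.τ) I.agents = true ↔ I.toGame.τ ≤ 0 ∨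
    ∃ i j : Fin I.n,
      I.toGame.contribution {k | I.toGame.e k / I.toGame.m k ≤ I.toGame.e i / I.toGame.m i ∧
          I.toGame.e j < I.toGame.e k} < I.toGame.τ ∧
      I.toGame.τ ≤ fracVal (Agent.greedySum (frac I.τ) I.agents (I.agent i) (I.agent j)) ∧
      I.toGame.e i / I.toGame.m i ≤
        fracVal (Agent.greedySum (frac I.τ) I.agents (I.agent i) (I.agent j)) := by
  have hτ : fracVal (frac I.τ) = I.toGame.τ := fracVal_frac I.τ_nonneg
  have hany : ∀ c : Agent → Bool, I.agents.any c = true ↔ ∃ i, c (I.agent i) = true := by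
    intro c
    simp [agents, agent]
  rw [Agent.accepts, Bool.or_eq_true, fracLe_iff (frac_den_pos _) Nat.one_pos, hτ, hany]
  refine or_congr (by simp [fracVal]) (exists_congr fun i => ?_)
  rw [hany]
  refine exists_congr fun j => ?_
  obtain ⟨hd, hX⟩ := I.sumAbove_spec i j
  rw [Bool.and_eq_true, Bool.not_eq_true', fracLe_eq_false_iff (frac_den_pos _) hd, hX, hτ]
  refine and_congr_right fun h => ?_
  have hd' := (I.greedySum_spec i j h).1
  rw [Bool.and_eq_true, fracLe_iff (frac_den_pos _) hd', fracLe_iff (I.demand_den_pos i) hd', hτ,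
    fracVal_demand]

/-- The greedy set overshoots `τ` by less than the weight of `j`, and no member is lighter than `j`,
so every member is pivotal; the last test covers all demands. Balancedness plays no role. -/
theorem exists_isCooperativeNash_of_accepts (h : Agent.accepts (frac I.τ) I.agents = true) :
    ∃ S : Finset (Fin I.n), I.toGame.IsCooperativeNash S := by
  rcases I.accepts_iff.1 h with h | ⟨i, j, h, hτ, hi⟩
  · exact ⟨∅, PivotalGame.isCooperativeNash_of_pivotal
      (by simpa [PivotalGame.Succeeds, PivotalGame.contribution] using h) (by simp)⟩
  · obtain ⟨-, P, hP, h₁, h₂, -, -⟩ := I.greedySum_spec i j h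
    rw [hP] at hτ hi
    exact ⟨P, PivotalGame.isCooperativeNash_of_demand_le hτ (fun k hk => (h₁ k hk).2) h₂
      (fun k hk => (h₁ k hk).1) hi⟩

/-- The greedy set for the largest demand occurring among the positive members of `S` passes the
tests: it contributes at least as much as `S`, which already meets that demand. -/
theorem accepts_of_isCooperativeNash (hI : I.toGame.IsBalanced) {S : Finset (Fin I.n)}
    (hS : I.toGame.IsCooperativeNash S) : Agent.accepts (frac I.τ) I.agents = true := by
  rw [accepts_iff]
  refine or_iff_not_imp_left.2 fun hτ => ?_
  rw [not_le] at hτ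
  obtain ⟨hmin, hc⟩ := hS.isMinimal
  set S' : Finset (Fin I.n) := {i ∈ S | 0 < I.toGame.e i} with hS'
  have hne : S'.Nonempty := by
    rw [Finset.nonempty_iff_ne_empty]
    intro h
    have h' := hmin.1
    rw [h] at h'
    exact absurd hτ (not_lt.2 h')
  obtain ⟨i, hi, hmax⟩ := S'.exists_max_image (fun k => I.toGame.e k / I.toGame.m k) hne
  set A : Finset (Fin I.n) := {k | I.toGame.e k / I.toGame.m k ≤ I.toGame.e i / I.toGame.m i}
    with hA
  have hS'A : S' ⊆ A := fun k hk => Finset.mem_filter.2 ⟨Finset.mem_univ _, hmax k hk⟩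
  have hAs : I.toGame.Succeeds A := le_trans (b := I.toGame.contribution S') hmin.1
    (Finset.sum_le_sum_of_subset_of_nonneg hS'A fun k _ _ => I.toGame.e_nonneg k)
  obtain ⟨j, -, hj₁, hj₂⟩ := PivotalGame.exists_critical hτ hAs
  rw [hA, Finset.filter_filter] at hj₁
  obtain ⟨-, P, hP, h₁, h₂, h₃, h₄⟩ := I.greedySum_spec i j hj₁
  -- If the greedy set fell short it would contain every agent of `A` at least as heavy as `j`, and
  -- those succeed.
  have hPτ : I.toGame.τ ≤ I.toGame.contribution P := by
    by_contra! hlt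
    have := hj₂.trans (Finset.sum_le_sum_of_subset_of_nonneg (t := P) (fun k hk => by
      rw [Finset.mem_filter, hA, Finset.mem_filter] at hk
      exact h₄ hlt k hk.1.2 hk.2) fun k _ _ => I.toGame.e_nonneg k)
    exact absurd hlt (not_lt.2 this)
  have hPmin : I.toGame.IsMinimal P := ⟨hPτ, fun k hk => by
    rw [PivotalGame.contribution_erase hk]
    linarith [(h₁ k hk).2]⟩
  refine ⟨i, j, hj₁, by rwa [hP], ?_⟩
  rw [hP]
  -- Members of `S'` outside `P` are no heavier than `j`, because `P` contains all strictly heavier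
  -- agents of `A`.
  have hle := hI.contribution_le hmin hPmin (fun k hk => (h₁ k hk).2) fun k hk hkP => by
    by_contra! hlt
    exact hkP (h₃ k (hmax k hk) hlt)
  refine le_trans ?_ hle
  rw [hS', Finset.mem_filter] at hi
  rw [hc, div_le_iff₀ (I.toGame.m_pos i), mul_comm]
  exact (hS.pivotal hi.1 hi.2).2

end RationalInstance

theorem mainTheorem6 :
    ∃ L : Language Computability.Γ', InP L ∧
      ∀ I : RationalInstance, I.toGame.IsBalanced →
        (I.encode ∈ L ↔ ∃ S : Finset (Fin I.n), I.toGame.IsCooperativeNash S) :=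
  ⟨decidedLanguage decideInput, inP_decideInput, fun I hI =>
    I.encode_mem_decidedLanguage.trans ⟨I.exists_isCooperativeNash_of_accepts,
      fun ⟨_, hS⟩ => I.accepts_of_isCooperativeNash hI hS⟩⟩
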